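/- Let $a<b$, $n\ge 1$, and let $H\in L_1\big((a-b,b-a);\mathbb C^{n\times n}\big)$ be even, i.e. $H(-t)=H(t)$ for almost every $t$. Suppose that for every $\xi\in[a,b]$ the equation $$g(t,\xi)+\int_a^\xi H(t-s)\,g(s,\xi)\,ds=I\qquad(a\le t\le\xi)$$ has a unique continuous $n\times n$ matrix solution $g(\cdot,\xi)$ on $[a,\xi]$. Then for every $\xi\in[a,b]$ the equation $$g^*(t,\xi)+\int_a^\xi g^*(s,\xi)\,H(s-t)\,ds=I\qquad(a\le t\le\xi)$$ also has a unique continuous solution $g^*(\cdot,\xi)$ on $[a,\xi]$ (the star is part of the name and is not the conjugate transpose), and $$\det\big[g^*(\xi,\xi)\,g(\xi,\xi)\big]\ne0\qquad(a\le\xi\le b).$$ The function $M(\xi)=\int_a^\xi g(t,\xi)\,dt$ is differentiable on $[a,b]$ with $M'(\xi)=g^*(\xi,\xi)g(\xi,\xi)$ (derivatives at end points are one-sided). For every continuous $f:[a,b]\to\mathbb C^n$ the function $\xi\mapsto\int_a^\xi g^*(s,\xi)f(s)\,ds$ is differentiable on $[a,b]$, the function $$F(\xi)=M'(\xi)^{-1}\,\frac{d}{d\xi}\int_a^\xi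 g^*(s,\xi)f(s)\,ds$$ is continuous on $[a,b]$, and the equation $$\varphi(t)+\int_a^b H(t-s)\varphi(s)\,ds=f(t)\qquad(a\le t\le b)$$ has a unique continuous solution $\varphi$, given by $$\varphi(t)=g(t,b)F(b)-\int_t^b g(t,\xi)\,dF(\xi)\qquad(a\le t\le b),$$ where the integral exists as a Riemann--Stieltjes integral. If $f$ is absolutely continuous on $[a,b]$, then $F$ is absolutely continuous on $[a,b]$, hence differentiable almost everywhere, and $$\varphi(t)=g(t,b)F(b)-\int_t^b g(t,\xi)\,\frac{dF}{d\xi}(\xi)\,d\xi\qquad(a\le t\le b)$$ with a Lebesgue integral. -/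

import Mathlib

open Set MeasureTheory
open scoped Matrix

noncomputable section

namespace KreinMethod

/-- Entrywise integral `∫_c^d A(s) ds` of a matrix function. -/
def matIntegral {n : ℕ} (A : ℝ → Matrix (Fin n) (Fin n) ℂ) (c d : ℝ) :
    Matrix (Fin n) (Fin n) ℂ :=
  Matrix.of fun i j => ∫ s in c..d, A s i j

/-- Entrywise derivative at `ξ` of a matrix function on the set `S`. -/
def matDerivWithin {n : ℕ} (A : ℝ → Matrix (Fin n) (Fin n) ℂ) (S : Set ℝ) (ξ : ℝ) :
    Matrix (Fin n) (Fin n) ℂ :=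
  Matrix.of fun i j => derivWithin (fun η => A η i j) S ξ

/-- `H` is an integrable matrix function on `(-r, r)`. -/
def IsIntegrableKernel {n : ℕ} (H : ℝ → Matrix (Fin n) (Fin n) ℂ) (r : ℝ) : Prop :=
  ∀ i j, IntegrableOn (fun t => H t i j) (Ioo (-r) r)

/-- `H` is even, as an element of `L₁(-r, r)`: `H(-t) = H(t)` for almost every `t`. -/
def IsEvenKernel {n : ℕ} (H : ℝ → Matrix (Fin n) (Fin n) ℂ) (r : ℝ) : Prop :=
  ∀ᵐ t ∂(volume.restrict (Ioo (-r) r)), H (-t) = H t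

/-- `u` is a continuous solution on `[a, ξ]` of `u(t) + ∫_a^ξ H(t-s) u(s) ds = I`. -/
def IsTruncatedSolution {n : ℕ} (H : ℝ → Matrix (Fin n) (Fin n) ℂ) (a ξ : ℝ)
    (u : ℝ → Matrix (Fin n) (Fin n) ℂ) : Prop :=
  ContinuousOn u (Icc a ξ) ∧
    ∀ t ∈ Icc a ξ, u t + matIntegral (fun s => H (t - s) * u s) a ξ = 1

/-- `u` is a continuous solution on `[a, ξ]` of `u(t) + ∫_a^ξ u(s) H(s-t) ds = I`. -/
def IsDualTruncatedSolution {n : ℕ} (H : ℝ → Matrix (Fin n) (Fin n) ℂ) (a ξ : ℝ)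
    (u : ℝ → Matrix (Fin n) (Fin n) ℂ) : Prop :=
  ContinuousOn u (Icc a ξ) ∧
    ∀ t ∈ Icc a ξ, u t + matIntegral (fun s => u s * H (s - t)) a ξ = 1

/-- `φ` is a continuous solution on `[a, b]` of `φ(t) + ∫_a^b H(t-s) φ(s) ds = f(t)`. -/
def IsSolution {n : ℕ} (H : ℝ → Matrix (Fin n) (Fin n) ℂ) (a b : ℝ)
    (f φ : ℝ → Fin n → ℂ) : Prop :=
  ContinuousOn φ (Icc a b) ∧
    ∀ t ∈ Icc a b, φ t + ∫ s in a..b, H (t - s) *ᵥ φ s = f t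

/-- `u` has the property `P`, and is the only such function up to values outside `[c, d]`. -/
def IsUniqueOn {E : Type*} (P : (ℝ → E) → Prop) (c d : ℝ) (u : ℝ → E) : Prop :=
  P u ∧ ∀ v, P v → EqOn v u (Icc c d)

/-- `M(ξ) = ∫_a^ξ g(t, ξ) dt`. -/
def M {n : ℕ} (g : ℝ → ℝ → Matrix (Fin n) (Fin n) ℂ) (a ξ : ℝ) : Matrix (Fin n) (Fin n) ℂ :=
  matIntegral (fun t => g t ξ) a ξ

/-- `∫_a^ξ g*(s, ξ) f(s) ds`. -/
def dualMoment {n : ℕ} (gs : ℝ → ℝ → Matrix (Fin n) (Fin n) ℂ) (f : ℝ → Fin n → ℂ) (a ξ : ℝ) :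
    Fin n → ℂ :=
  ∫ s in a..ξ, gs s ξ *ᵥ f s

/-- `F(ξ) = M'(ξ)⁻¹ (d/dξ) ∫_a^ξ g*(s, ξ) f(s) ds` for `ξ ∈ [a, b]`, with one-sided derivatives at
the end points. -/
def kreinF {n : ℕ} (g gs : ℝ → ℝ → Matrix (Fin n) (Fin n) ℂ) (f : ℝ → Fin n → ℂ) (a b ξ : ℝ) :
    Fin n → ℂ :=
  (matDerivWithin (M g a) (Icc a b) ξ)⁻¹ *ᵥ derivWithin (dualMoment gs f a) (Icc a b) ξ

/-- `J` is the Riemann-Stieltjes integral `∫_c^d A(ξ) dF(ξ)`: the limit, as the mesh tends to `0`,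
of the sums `∑ A(τ_i) (F(x_{i+1}) - F(x_i))` over partitions `c = x_0 ≤ … ≤ x_N = d` with tags
`τ_i ∈ [x_i, x_{i+1}]`. -/
def HasStieltjesIntegral {n : ℕ} (A : ℝ → Matrix (Fin n) (Fin n) ℂ) (F : ℝ → Fin n → ℂ)
    (c d : ℝ) (J : Fin n → ℂ) : Prop :=
  ∀ ε > (0 : ℝ), ∃ δ > (0 : ℝ), ∀ (N : ℕ) (x τ : ℕ → ℝ), x 0 = c → x N = d →
    (∀ i < N, x i ≤ τ i ∧ τ i ≤ x (i + 1) ∧ x (i + 1) - x i < δ) →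
    ‖(∑ i ∈ Finset.range N, A (τ i) *ᵥ (F (x (i + 1)) - F (x i))) - J‖ < ε

end KreinMethod

end

noncomputable section

namespace KreinMethod

open Filter Topology

variable {n : ℕ}

/-! Let `T_ξ u(t) = ∫_a^ξ H(t-s) u(s) ds` on the continuous functions on `[a, b]`. Each `T_ξ` is
compact and depends norm-continuously on `ξ`, and unique solvability makes `1 + T_ξ` injective; the
Fredholm alternative gives inverses that are continuous in `ξ` and uniformly bounded
(`exists_solution`). Pairing with the transposed kernel carries solvability over to the dual
equation.

Since `H` is merely integrable, the truncated solutions need not be differentiable in `ξ`. The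
substitute is a bound on sums (`exists_sum_norm_le`): if many functions solve equations truncated at
different points, the sum of their norms is controlled by the sum of the norms of their right-hand
sides. Sums of increments in `ξ` are thereby controlled.

Three uses carry the theorem. Evenness makes the convolution commute with the reflection `s ↦ ξ + a
- s`, so increments of the diagonal value `φ_ξ(ξ)` solve a truncated equation; with a constant
right-hand side this is a Gronwall-type inequality, and a diagonal value that vanished once would
vanish back to `a`, where it equals the constant (`diagonal_ne_zero`). Adjointness gives the exact
increments `∫_ξ^η χ_ξ · φ_η` of the moments, hence `M' = g*(ξ,ξ) g(ξ,ξ)` and `F(ξ) = g(ξ,ξ)⁻¹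
φ_ξ(ξ)`, where `φ_ξ` solves the equation truncated at `ξ` with right-hand side `f`.

Finally, `φ_β - g(·,β) F(x)` is small near `x` when `β` is near `x`. By Abel summation the error of
a Stieltjes sum is a sum of increments of such functions, which the bound on sums makes small
although `F` need not have bounded variation (`hasStieltjesIntegral`). The same bound on diagonal
increments transfers absolute continuity from `f` to `F`, and the Stieltjes integral becomes a
Lebesgue integral. -/

/-- A bound for the action of a matrix on vectors with the supremum norm. -/
def opBound (A : Matrix (Fin n) (Fin n) ℂ) : ℝ :=
  n * ‖(fun i j => A i j : Fin n → Fin n → ℂ)‖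

lemma opBound_nonneg (A : Matrix (Fin n) (Fin n) ℂ) : 0 ≤ opBound A := by
  unfold opBound; positivity

lemma norm_mulVec_le (A : Matrix (Fin n) (Fin n) ℂ) (v : Fin n → ℂ) :
    ‖A *ᵥ v‖ ≤ opBound A * ‖v‖ := by
  refine (pi_norm_le_iff_of_nonneg (mul_nonneg (opBound_nonneg A) (norm_nonneg v))).2 fun i => ?_
  calc ‖(A *ᵥ v) i‖ ≤ ∑ j, ‖A i j * v j‖ := by
        rw [Matrix.mulVec, dotProduct]; exact norm_sum_le _ _
    _ ≤ ∑ _j : Fin n, ‖(fun i j => A i j : Fin n → Fin n → ℂ)‖ * ‖v‖ := by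
        refine Finset.sum_le_sum fun j _ => ?_
        rw [norm_mul]
        refine mul_le_mul ?_ (norm_le_pi_norm v j) (norm_nonneg _) (norm_nonneg _)
        exact (norm_le_pi_norm (fun j => A i j) j).trans
          (norm_le_pi_norm (fun i j => A i j : Fin n → Fin n → ℂ) i)
    _ = opBound A * ‖v‖ := by simp [opBound, mul_assoc]

/-! ### Truncated convolutions with an integrable kernel -/

/-- An integrable kernel on the line which is even everywhere. -/
structure EvenKernel (H : ℝ → Matrix (Fin n) (Fin n) ℂ) : Prop where
  integrable : ∀ i j, Integrable fun t => H t i j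
  even : ∀ t, H (-t) = H t

/-- The truncated convolution `∫_a^ξ H(t - s) u(s) ds`. -/
def convOp (H : ℝ → Matrix (Fin n) (Fin n) ℂ) (a ξ : ℝ) (u : ℝ → Fin n → ℂ) (t : ℝ) :
    Fin n → ℂ :=
  ∫ s in a..ξ, H (t - s) *ᵥ u s

namespace EvenKernel

variable {H : ℝ → Matrix (Fin n) (Fin n) ℂ} (hH : EvenKernel H)
include hH

lemma transpose : EvenKernel fun t => (H t)ᵀ :=
  ⟨fun i j => hH.integrable j i, fun t => by rw [hH.even]⟩

lemma sub_comm (x y : ℝ) : H (x - y) = H (y - x) := by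
  rw [← hH.even, neg_sub]

lemma integrable_pi : Integrable fun t => (fun i j => H t i j : Fin n → Fin n → ℂ) :=
  Integrable.of_eval fun i => Integrable.of_eval fun j => hH.integrable i j

lemma integrable_opBound : Integrable fun t => opBound (H t) :=
  hH.integrable_pi.norm.const_mul _

lemma intervalIntegrable_opBound (t c d : ℝ) :
    IntervalIntegrable (fun s => opBound (H (t - s))) volume c d :=
  (hH.integrable_opBound.comp_sub_left t).intervalIntegrable

lemma intervalIntegrable_mulVec {u : ℝ → Fin n → ℂ} (hu : Continuous u) (t c d : ℝ) :
    IntervalIntegrable (fun s => H (t - s) *ᵥ u s) volume c d := by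
  rw [intervalIntegrable_iff]
  refine Integrable.of_eval fun i => ?_
  simp only [Matrix.mulVec, dotProduct]
  refine integrable_finsetSum _ fun j _ => ?_
  have h1 : IntervalIntegrable (fun s => H (t - s) i j) volume c d :=
    ((hH.integrable i j).comp_sub_left t).intervalIntegrable
  exact intervalIntegrable_iff.1 (h1.mul_continuousOn (by fun_prop))

lemma intervalIntegrable_opBound_mul {u : ℝ → ℝ} (hu : Continuous u) (t c d : ℝ) :
    IntervalIntegrable (fun s => opBound (H (t - s)) * u s) volume c d :=
  (hH.intervalIntegrable_opBound t c d).mul_continuousOn hu.continuousOn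

lemma norm_integral_mulVec_le {u : ℝ → Fin n → ℂ} (hu : Continuous u) (t : ℝ) {c d : ℝ}
    (hcd : c ≤ d) :
    ‖∫ s in c..d, H (t - s) *ᵥ u s‖ ≤ ∫ s in c..d, opBound (H (t - s)) * ‖u s‖ := by
  refine (intervalIntegral.norm_integral_le_integral_norm hcd).trans ?_
  exact intervalIntegral.integral_mono_on hcd (hH.intervalIntegrable_mulVec hu t c d).norm
    (hH.intervalIntegrable_opBound_mul hu.norm t c d) fun s _ => norm_mulVec_le _ _

lemma norm_integral_mulVec_le_mul {u : ℝ → Fin n → ℂ} (hu : Continuous u) (t : ℝ) {c d M : ℝ}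
    (hcd : c ≤ d) (hM : ∀ s ∈ Icc c d, ‖u s‖ ≤ M) :
    ‖∫ s in c..d, H (t - s) *ᵥ u s‖ ≤ M * ∫ s in c..d, opBound (H (t - s)) := by
  refine (hH.norm_integral_mulVec_le hu t hcd).trans ?_
  rw [← intervalIntegral.integral_const_mul]
  refine intervalIntegral.integral_mono_on hcd (hH.intervalIntegrable_opBound_mul hu.norm t c d)
    ((hH.intervalIntegrable_opBound t c d).const_mul M) fun s hs => ?_
  rw [mul_comm]
  exact mul_le_mul_of_nonneg_right (hM s hs) (opBound_nonneg _)

lemma integral_opBound_le (t : ℝ) {c d : ℝ} (hcd : c ≤ d) :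
    ∫ s in c..d, opBound (H (t - s)) ≤ ∫ x, opBound (H x) := by
  rw [intervalIntegral.integral_of_le hcd, ← integral_sub_left_eq_self (fun x => opBound (H x)) _ t]
  exact setIntegral_le_integral (hH.integrable_opBound.comp_sub_left t)
    (Eventually.of_forall fun _ => opBound_nonneg _)

lemma convOp_sub {u v : ℝ → Fin n → ℂ} (hu : Continuous u) (hv : Continuous v) (a ξ t : ℝ) :
    convOp H a ξ (fun s => u s - v s) t = convOp H a ξ u t - convOp H a ξ v t := by
  simp only [convOp, Matrix.mulVec_sub]
  exact intervalIntegral.integral_sub (hH.intervalIntegrable_mulVec hu t a ξ)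
    (hH.intervalIntegrable_mulVec hv t a ξ)

lemma convOp_add {u v : ℝ → Fin n → ℂ} (hu : Continuous u) (hv : Continuous v) (a ξ t : ℝ) :
    convOp H a ξ (fun s => u s + v s) t = convOp H a ξ u t + convOp H a ξ v t := by
  simp only [convOp, Matrix.mulVec_add]
  exact intervalIntegral.integral_add (hH.intervalIntegrable_mulVec hu t a ξ)
    (hH.intervalIntegrable_mulVec hv t a ξ)

omit hH in
lemma convOp_smul (c : ℂ) (u : ℝ → Fin n → ℂ) (a ξ t : ℝ) :
    convOp H a ξ (fun s => c • u s) t = c • convOp H a ξ u t := by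
  simp only [convOp, Matrix.mulVec_smul]
  exact intervalIntegral.integral_smul _ _

lemma convOp_split {u : ℝ → Fin n → ℂ} (hu : Continuous u) (a ξ η t : ℝ) :
    convOp H a η u t = convOp H a ξ u t + ∫ s in ξ..η, H (t - s) *ᵥ u s :=
  (intervalIntegral.integral_add_adjacent_intervals (hH.intervalIntegrable_mulVec hu t a ξ)
    (hH.intervalIntegrable_mulVec hu t ξ η)).symm

end EvenKernel

lemma convOp_congr {H : ℝ → Matrix (Fin n) (Fin n) ℂ} {a ξ : ℝ} (hξ : a ≤ ξ)
    {u v : ℝ → Fin n → ℂ} (h : EqOn u v (Icc a ξ)) (t : ℝ) :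
    convOp H a ξ u t = convOp H a ξ v t := by
  refine intervalIntegral.integral_congr fun s hs => ?_
  rw [uIcc_of_le hξ] at hs
  simp only [h hs]

/-- Translation is continuous in mean, uniformly in the base point. -/
lemma exists_integral_translate_le {E : Type*} [NormedAddCommGroup E] [NormedSpace ℝ E]
    {h : ℝ → E} (hh : Integrable h) {a b : ℝ} (hab : a ≤ b) {ε : ℝ} (hε : 0 < ε) :
    ∃ δ > 0, ∀ t t' : ℝ, |t - t'| < δ → ∫ s in a..b, ‖h (t - s) - h (t' - s)‖ ≤ ε := by
  -- Approximation in mean by a compactly supported continuous function, which is uniformly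
  -- continuous; the two approximation errors and the oscillation get a third of `ε` each. The `+ 1`
  -- below keeps the denominator positive when `a = b`.
  obtain ⟨g, hgs, hg, hgc, hgi⟩ := hh.exists_hasCompactSupport_integral_sub_le
    (show 0 < ε / 3 by positivity)
  have huc : UniformContinuous g := hgc.uniformContinuous_of_tendsto_cocompact hgs.is_zero_at_infty
  obtain ⟨δ, hδ, hgδ⟩ := Metric.uniformContinuous_iff.1 huc (ε / (3 * (b - a + 1)))
    (by have : 0 ≤ b - a := by linarith
        positivity)
  refine ⟨δ, hδ, fun t t' htt => ?_⟩
  have hI : ∀ x : ℝ, IntervalIntegrable (fun s => ‖h (x - s) - g (x - s)‖) volume a b := fun x =>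
    ((hh.sub hgi).comp_sub_left x).norm.intervalIntegrable
  have hB : ∀ x : ℝ, ∫ s in a..b, ‖h (x - s) - g (x - s)‖ ≤ ε / 3 := fun x => by
    refine le_trans ?_ hg
    rw [intervalIntegral.integral_of_le hab,
      ← integral_sub_left_eq_self (fun x => ‖h x - g x‖) _ x]
    exact setIntegral_le_integral ((hh.sub hgi).comp_sub_left x).norm
      (Eventually.of_forall fun _ => norm_nonneg _)
  have hpt : ∀ s, ‖h (t - s) - h (t' - s)‖ ≤
      ‖h (t - s) - g (t - s)‖ + ‖h (t' - s) - g (t' - s)‖ + ε / (3 * (b - a + 1)) := fun s => by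
    have h1 : ‖g (t - s) - g (t' - s)‖ ≤ ε / (3 * (b - a + 1)) := by
      rw [← dist_eq_norm]
      refine (hgδ ?_).le
      rw [Real.dist_eq]; simpa using htt
    calc ‖h (t - s) - h (t' - s)‖
        = ‖(h (t - s) - g (t - s)) - (h (t' - s) - g (t' - s)) + (g (t - s) - g (t' - s))‖ := by
          congr 1; abel
      _ ≤ _ := (norm_add_le _ _).trans (add_le_add (norm_sub_le _ _) h1)
  calc ∫ s in a..b, ‖h (t - s) - h (t' - s)‖
      ≤ ∫ s in a..b, (‖h (t - s) - g (t - s)‖ + ‖h (t' - s) - g (t' - s)‖ +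
          ε / (3 * (b - a + 1))) :=
        intervalIntegral.integral_mono_on hab
          ((hh.comp_sub_left t).sub (hh.comp_sub_left t')).norm.intervalIntegrable
          (((hI t).add (hI t')).add intervalIntegrable_const) fun s _ => hpt s
    _ = (∫ s in a..b, ‖h (t - s) - g (t - s)‖) + (∫ s in a..b, ‖h (t' - s) - g (t' - s)‖) +
          (b - a) * (ε / (3 * (b - a + 1))) := by
        rw [intervalIntegral.integral_add ((hI t).add (hI t')) intervalIntegrable_const,
          intervalIntegral.integral_add (hI t) (hI t'), intervalIntegral.integral_const,
          smul_eq_mul]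
    _ ≤ ε / 3 + ε / 3 + ε / 3 := by
        refine add_le_add (add_le_add (hB t) (hB t')) ?_
        have : 0 < b - a + 1 := by linarith
        rw [mul_div_assoc', div_le_div_iff₀ (by positivity) (by norm_num)]
        nlinarith
    _ = ε := by ring

namespace EvenKernel

variable {H : ℝ → Matrix (Fin n) (Fin n) ℂ} (hH : EvenKernel H)
include hH

lemma exists_integral_opBound_translate_le {a b : ℝ} (hab : a ≤ b) {ε : ℝ} (hε : 0 < ε) :
    ∃ δ > 0, ∀ t t' : ℝ, |t - t'| < δ →
      ∫ s in a..b, opBound (H (t - s) - H (t' - s)) ≤ ε := by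
  obtain ⟨δ, hδ, h⟩ := exists_integral_translate_le hH.integrable_pi hab
    (show 0 < ε / (n + 1) by positivity)
  refine ⟨δ, hδ, fun t t' htt => ?_⟩
  have h1 := h t t' htt
  have h2 : ∫ s in a..b, opBound (H (t - s) - H (t' - s)) = n * ∫ s in a..b,
      ‖(fun i j => H (t - s) i j : Fin n → Fin n → ℂ) - fun i j => H (t' - s) i j‖ := by
    rw [← intervalIntegral.integral_const_mul]; rfl
  rw [h2]
  calc (n : ℝ) * _ ≤ n * (ε / (n + 1)) := by gcongr
    _ ≤ ε := by
        rw [mul_div_assoc', div_le_iff₀ (by positivity)]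
        nlinarith

lemma norm_convOp_sub_le {a b ξ M : ℝ} (hξ : ξ ∈ Icc a b) {u : ℝ → Fin n → ℂ}
    (hu : Continuous u) (hM0 : 0 ≤ M) (hM : ∀ s ∈ Icc a b, ‖u s‖ ≤ M) (t t' : ℝ) :
    ‖convOp H a ξ u t - convOp H a ξ u t'‖ ≤
      M * ∫ s in a..b, opBound (H (t - s) - H (t' - s)) := by
  have hI : ∀ c d, IntervalIntegrable (fun s => opBound (H (t - s) - H (t' - s))) volume c d :=
    fun c d => (((hH.integrable_pi.comp_sub_left t).sub
      (hH.integrable_pi.comp_sub_left t')).norm.const_mul _).intervalIntegrable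
  have h0 : convOp H a ξ u t - convOp H a ξ u t' =
      ∫ s in a..ξ, (H (t - s) - H (t' - s)) *ᵥ u s := by
    simp only [convOp, Matrix.sub_mulVec]
    exact (intervalIntegral.integral_sub (hH.intervalIntegrable_mulVec hu t a ξ)
      (hH.intervalIntegrable_mulVec hu t' a ξ)).symm
  rw [h0]
  calc ‖∫ s in a..ξ, (H (t - s) - H (t' - s)) *ᵥ u s‖
      ≤ ∫ s in a..ξ, M * opBound (H (t - s) - H (t' - s)) := by
        refine intervalIntegral.norm_integral_le_of_norm_le hξ.1 ?_ ((hI a ξ).const_mul M)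
        refine Eventually.of_forall fun s hs => (norm_mulVec_le _ _).trans ?_
        rw [mul_comm]
        exact mul_le_mul_of_nonneg_right (hM s ⟨hs.1.le, hs.2.trans hξ.2⟩) (opBound_nonneg _)
    _ = M * ∫ s in a..ξ, opBound (H (t - s) - H (t' - s)) :=
        intervalIntegral.integral_const_mul _ _
    _ ≤ _ := by
        refine mul_le_mul_of_nonneg_left ?_ hM0
        exact intervalIntegral.integral_mono_interval le_rfl hξ.1 hξ.2
          (Eventually.of_forall fun s => opBound_nonneg _) (hI a b)

lemma continuous_convOp {a ξ : ℝ} (hξ : a ≤ ξ) {u : ℝ → Fin n → ℂ} (hu : Continuous u) :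
    Continuous (convOp H a ξ u) := by
  obtain ⟨M, hM⟩ := isCompact_Icc.exists_bound_of_continuousOn (s := Icc a ξ) hu.continuousOn
  have hM0 : 0 ≤ M := (norm_nonneg _).trans (hM a ⟨le_rfl, hξ⟩)
  rw [Metric.continuous_iff]
  intro t ε hε
  obtain ⟨δ, hδ, h⟩ := hH.exists_integral_opBound_translate_le hξ
    (show 0 < ε / (2 * (M + 1)) by positivity)
  refine ⟨δ, hδ, fun t' ht' => ?_⟩
  rw [dist_eq_norm]
  refine (hH.norm_convOp_sub_le ⟨hξ, le_rfl⟩ hu hM0 hM t' t).trans_lt ?_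
  refine (mul_le_mul_of_nonneg_left (h t' t ht') hM0).trans_lt ?_
  rw [mul_div_assoc', div_lt_iff₀ (by positivity)]
  nlinarith

/-- The kernel has small mass on short intervals. -/
lemma exists_integral_opBound_le {ε : ℝ} (hε : 0 < ε) (a b : ℝ) :
    ∃ δ > 0, ∀ t ∈ Icc a b, ∀ c ∈ Icc a b, ∀ d ∈ Icc a b, c ≤ d → d - c < δ →
      ∫ s in c..d, opBound (H (t - s)) ≤ ε := by
  -- The mass over `[c, d]` is an increment of the primitive of `opBound (H ·)`, which is uniformly
  -- continuous on `[a - b, b - a]`, where every difference `t - s` lies.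
  have hc : Continuous fun x : ℝ => ∫ y in (0 : ℝ)..x, opBound (H y) :=
    intervalIntegral.continuous_primitive (fun _ _ => hH.integrable_opBound.intervalIntegrable) 0
  have huc := (isCompact_Icc (a := a - b) (b := b - a)).uniformContinuousOn_of_continuous
    hc.continuousOn
  obtain ⟨δ, hδ, h⟩ := Metric.uniformContinuousOn_iff.1 huc ε hε
  refine ⟨δ, hδ, fun t ht c hc d hd hcd hlt => ?_⟩
  rw [intervalIntegral.integral_comp_sub_left (fun x => opBound (H x)) t,
    ← intervalIntegral.integral_interval_sub_left
      (hH.integrable_opBound.intervalIntegrable (a := 0))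
      (hH.integrable_opBound.intervalIntegrable (a := 0))]
  have := h (t - c) ⟨by linarith [ht.1, hc.2], by linarith [ht.2, hc.1]⟩ (t - d)
    ⟨by linarith [ht.1, hd.2], by linarith [ht.2, hd.1]⟩
    (by rw [Real.dist_eq, show t - c - (t - d) = d - c by ring, abs_of_nonneg (by linarith)]
        exact hlt)
  rw [Real.dist_eq] at this
  exact (le_abs_self _).trans this.le

end EvenKernel

/-! ### Invertibility of the truncated operators -/

/-- The homogeneous truncated equations on `[a, ξ]`, `ξ ∈ [a, b]`, have only trivial solutions. -/
def InjectiveTruncations (H : ℝ → Matrix (Fin n) (Fin n) ℂ) (a b : ℝ) : Prop :=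
  ∀ ξ ∈ Icc a b, ∀ u : ℝ → Fin n → ℂ, Continuous u →
    (∀ t ∈ Icc a ξ, u t + convOp H a ξ u t = 0) → ∀ t ∈ Icc a ξ, u t = 0

/-- A norm-continuous compact family `T` with every `1 + T k` injective has a continuous, uniformly
bounded family of inverses. -/
lemma exists_inverse_one_add {X K : Type*} [NormedAddCommGroup X] [NormedSpace ℂ X]
    [CompleteSpace X] [TopologicalSpace K] [CompactSpace K] (T : K → X →L[ℂ] X)
    (hT : ∀ k, Tendsto (fun l => ‖T l - T k‖) (𝓝 k) (𝓝 0))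
    (hcomp : ∀ k, IsCompactOperator (T k)) (hinj : ∀ k v, v + T k v = 0 → v = 0) :
    ∃ C : ℝ, 0 ≤ C ∧ ∃ R : K → X → X, (∀ x, Continuous fun k => R k x) ∧
      (∀ k x, R k x + T k (R k x) = x) ∧ ∀ k x, ‖R k x‖ ≤ C * ‖x‖ := by
  have hc : Continuous T := continuous_iff_continuousAt.2 fun k =>
    tendsto_iff_norm_sub_tendsto_zero.2 (hT k)
  have hu : ∀ k, IsUnit (1 + T k) := by
    intro k
    -- Fredholm alternative at `-1`: an eigenvector would contradict injectivity.
    rcases (hcomp k).hasEigenvalue_or_mem_resolventSet (μ := (-1 : ℂ)) (by norm_num) with h | h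
    · exfalso
      obtain ⟨v, hv⟩ := h.exists_hasEigenvector
      have hv1 : T k v = (-1 : ℂ) • v := hv.apply_eq_smul
      exact hv.2 (hinj k v (by rw [hv1]; simp))
    · have h1 : IsUnit (algebraMap ℂ (X →L[ℂ] X) (-1 : ℂ) - T k) := h
      rw [show 1 + T k = -(algebraMap ℂ (X →L[ℂ] X) (-1 : ℂ) - T k) by
        rw [map_neg, map_one]; abel]
      exact h1.neg
  -- Inversion is continuous at units, and compactness of the parameter space makes the norms of the
  -- inverses bounded.
  have hR : Continuous fun k => Ring.inverse (1 + T k) := by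
    rw [continuous_iff_continuousAt]
    intro k
    obtain ⟨w, hw⟩ := hu k
    have h1 := NormedRing.inverse_continuousAt w
    rw [hw] at h1
    exact h1.comp (f := fun k => 1 + T k) (continuous_const.add hc).continuousAt
  obtain ⟨C, hC⟩ := isCompact_univ.exists_bound_of_continuousOn hR.continuousOn
  refine ⟨max C 0, le_max_right _ _, fun k x => Ring.inverse (1 + T k) x,
    fun x => hR.clm_apply continuous_const, fun k x => ?_, fun k x => ?_⟩
  · exact congrArg (fun A : X →L[ℂ] X => A x) (Ring.mul_inverse_cancel _ (hu k))
  · exact (ContinuousLinearMap.le_opNorm _ _).trans (mul_le_mul_of_nonneg_right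
      ((hC k (mem_univ _)).trans (le_max_left _ _)) (norm_nonneg _))

namespace EvenKernel

open BoundedContinuousFunction

variable {H : ℝ → Matrix (Fin n) (Fin n) ℂ} (hH : EvenKernel H) {a b : ℝ}

lemma continuous_extend (hab : a ≤ b) (u : Icc a b →ᵇ (Fin n → ℂ)) :
    Continuous (IccExtend hab u) :=
  u.continuous.Icc_extend'

lemma norm_extend_le (hab : a ≤ b) (u : Icc a b →ᵇ (Fin n → ℂ)) (s : ℝ) :
    ‖IccExtend hab u s‖ ≤ ‖u‖ :=
  u.norm_coe_le_norm _

include hH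

lemma norm_convOp_extend_le (hab : a ≤ b) (ξ : Icc a b) (u : Icc a b →ᵇ (Fin n → ℂ)) (t : ℝ) :
    ‖convOp H a ξ (IccExtend hab u) t‖ ≤ (∫ x, opBound (H x)) * ‖u‖ := by
  refine (hH.norm_integral_mulVec_le_mul (continuous_extend hab u) t ξ.2.1
    fun s _ => norm_extend_le hab u s).trans ?_
  rw [mul_comm]
  exact mul_le_mul_of_nonneg_right (hH.integral_opBound_le t ξ.2.1) (norm_nonneg _)

/-- The truncated convolution as an operator on the continuous functions on `[a, b]`. -/
def truncOp (hab : a ≤ b) (ξ : Icc a b) :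
    (Icc a b →ᵇ (Fin n → ℂ)) →L[ℂ] (Icc a b →ᵇ (Fin n → ℂ)) :=
  LinearMap.mkContinuous
    { toFun := fun u => BoundedContinuousFunction.mkOfCompact
        ⟨fun t : Icc a b => convOp H a ξ (IccExtend hab u) t,
          (hH.continuous_convOp ξ.2.1 (continuous_extend hab u)).comp continuous_subtype_val⟩
      map_add' := fun u v => by
        ext1 t
        exact hH.convOp_add (continuous_extend hab u) (continuous_extend hab v) a ξ t
      map_smul' := fun c u => by
        ext1 t
        exact convOp_smul c (IccExtend hab u) a ξ t }
    (∫ x, opBound (H x))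
    fun u => by
      refine (BoundedContinuousFunction.norm_le (mul_nonneg
        (integral_nonneg fun _ => opBound_nonneg _) (norm_nonneg _))).2 fun t => ?_
      exact hH.norm_convOp_extend_le hab ξ u t

lemma truncOp_apply (hab : a ≤ b) (ξ t : Icc a b) (u : Icc a b →ᵇ (Fin n → ℂ)) :
    hH.truncOp hab ξ u t = convOp H a ξ (IccExtend hab u) t := rfl

/-- Arzelà–Ascoli: the oscillation of the image of `u` is at most `‖u‖` times the mean distance of
two translates of the kernel, so the image of the unit ball is equicontinuous. -/
lemma isCompactOperator_truncOp (hab : a ≤ b) (ξ : Icc a b) :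
    IsCompactOperator (hH.truncOp hab ξ) := by
  refine (isCompactOperator_iff_isCompact_closure_image_closedBall
    ((hH.truncOp hab ξ : (Icc a b →ᵇ (Fin n → ℂ)) →L[ℂ] (Icc a b →ᵇ (Fin n → ℂ))) :
      (Icc a b →ᵇ (Fin n → ℂ)) →ₗ[ℂ] (Icc a b →ᵇ (Fin n → ℂ))) one_pos).2 ?_
  refine BoundedContinuousFunction.arzela_ascoli
    (Metric.closedBall 0 (∫ x, opBound (H x))) (isCompact_closedBall _ _) _ ?_ ?_
  · rintro _ t ⟨u, hu, rfl⟩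
    rw [mem_closedBall_zero_iff] at hu ⊢
    refine (hH.norm_convOp_extend_le hab ξ u t).trans ?_
    exact mul_le_of_le_one_right (integral_nonneg fun _ => opBound_nonneg _) hu
  · refine fun t => Metric.equicontinuousAt_iff_right.2 fun ε hε => ?_
    obtain ⟨δ, hδ, h⟩ := hH.exists_integral_opBound_translate_le hab (half_pos hε)
    filter_upwards [Metric.ball_mem_nhds t hδ] with t' ht'
    rintro ⟨_, u, hu, rfl⟩
    rw [mem_closedBall_zero_iff] at hu
    rw [dist_eq_norm]
    refine (hH.norm_convOp_sub_le ξ.2 (continuous_extend hab u) zero_le_one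
      (fun s _ => (norm_extend_le hab u s).trans hu) t t').trans_lt ?_
    rw [one_mul]
    refine (h t t' ?_).trans_lt (half_lt_self hε)
    rw [← Real.dist_eq, dist_comm]; exact ht'

/-- Two truncations differ by an integral over the interval between the truncation points, and the
kernel has uniformly small mass on short intervals. -/
lemma tendsto_truncOp (hab : a ≤ b) (ξ : Icc a b) :
    Tendsto (fun η => ‖hH.truncOp hab η - hH.truncOp hab ξ‖) (𝓝 ξ) (𝓝 0) := by
  have key : ∀ ε > 0, ∃ δ > 0, ∀ ξ η : Icc a b, (ξ : ℝ) ≤ η → (η : ℝ) - ξ < δ →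
      ‖hH.truncOp hab η - hH.truncOp hab ξ‖ ≤ ε := by
    intro ε hε
    obtain ⟨δ, hδ, h⟩ := hH.exists_integral_opBound_le hε a b
    refine ⟨δ, hδ, fun ξ η hle hlt => ContinuousLinearMap.opNorm_le_bound _ hε.le fun u => ?_⟩
    refine (BoundedContinuousFunction.norm_le (by positivity)).2 fun t => ?_
    have h1 : (hH.truncOp hab η - hH.truncOp hab ξ) u t =
        ∫ s in (ξ : ℝ)..η, H (t - s) *ᵥ IccExtend hab u s := by
      change convOp H a η (IccExtend hab u) t - convOp H a ξ (IccExtend hab u) t = _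
      rw [hH.convOp_split (continuous_extend hab u) a ξ η t]; abel
    rw [h1]
    refine (hH.norm_integral_mulVec_le_mul (continuous_extend hab u) t hle
      fun s _ => norm_extend_le hab u s).trans ?_
    rw [mul_comm]
    exact mul_le_mul_of_nonneg_right (h t t.2 ξ ξ.2 η η.2 hle hlt) (norm_nonneg _)
  refine Metric.tendsto_nhds_nhds.2 fun ε hε => ?_
  obtain ⟨δ, hδ, h⟩ := key (ε / 2) (half_pos hε)
  refine ⟨δ, hδ, fun η hη => ?_⟩
  rw [dist_zero_right, Real.norm_eq_abs, abs_of_nonneg (ContinuousLinearMap.opNorm_nonneg _)]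
  rw [Subtype.dist_eq, Real.dist_eq] at hη
  rcases le_total (ξ : ℝ) η with hle | hle
  · exact (h ξ η hle ((le_abs_self _).trans_lt hη)).trans_lt (half_lt_self hε)
  · rw [norm_sub_rev]
    rw [abs_sub_comm] at hη
    exact (h η ξ hle ((le_abs_self _).trans_lt hη)).trans_lt (half_lt_self hε)

/-- The hypothesis kills `v` on `[a, ξ]` only. The convolution sees no other values, so it vanishes,
and the equation gives `v = 0` on all of `[a, b]`. -/
lemma eq_zero_of_add_truncOp_eq_zero (hab : a ≤ b) (hinj : InjectiveTruncations H a b)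
    (ξ : Icc a b) (v : Icc a b →ᵇ (Fin n → ℂ)) (hv : v + hH.truncOp hab ξ v = 0) : v = 0 := by
  have heq : ∀ t : Icc a b, v t + convOp H a ξ (IccExtend hab v) t = 0 := fun t => by
    rw [← hH.truncOp_apply]
    exact congrArg (fun u : Icc a b →ᵇ (Fin n → ℂ) => u t) hv
  have hz := hinj ξ ξ.2 (IccExtend hab v) (continuous_extend hab v) fun t ht => by
    have ht' : t ∈ Icc a b := ⟨ht.1, ht.2.trans ξ.2.2⟩
    rw [IccExtend_of_mem hab _ ht']
    exact heq ⟨t, ht'⟩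
  ext1 t
  have h0 : convOp H a ξ (IccExtend hab v) t = 0 := by
    rw [convOp_congr ξ.2.1 (v := fun _ => 0) hz]
    simp [convOp]
  simpa [h0] using heq t

/-- Continuous solvability of the truncated equations, with a uniform bound. -/
theorem exists_solution (hab : a ≤ b) (hinj : InjectiveTruncations H a b) :
    ∃ C : ℝ, 0 ≤ C ∧ ∀ f : ℝ → Fin n → ℂ, Continuous f → ∃ φ : ℝ → ℝ → Fin n → ℂ,
      Continuous (fun p : ℝ × ℝ => φ p.1 p.2) ∧
      (∀ ξ ∈ Icc a b, ∀ t ∈ Icc a b, φ ξ t + convOp H a ξ (φ ξ) t = f t) ∧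
      ∀ M, (∀ t ∈ Icc a b, ‖f t‖ ≤ M) → ∀ ξ t, ‖φ ξ t‖ ≤ C * M := by
  obtain ⟨C, hC0, R, hRc, hR, hRb⟩ := exists_inverse_one_add (hH.truncOp hab)
    (hH.tendsto_truncOp hab) (hH.isCompactOperator_truncOp hab)
    (hH.eq_zero_of_add_truncOp_eq_zero hab hinj)
  refine ⟨C, hC0, fun f hf => ?_⟩
  let f' : Icc a b →ᵇ (Fin n → ℂ) := BoundedContinuousFunction.mkOfCompact
    ⟨fun t : Icc a b => f t, hf.comp continuous_subtype_val⟩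
  -- Projecting both variables to `[a, b]` gives a function on the whole plane; joint continuity
  -- holds because evaluation is jointly continuous in the function and the point.
  refine ⟨fun ξ => IccExtend hab (R (projIcc a b hab ξ) f'), ?_, fun ξ hξ t ht => ?_,
    fun M hM ξ t => ?_⟩
  · have h1 : Continuous fun p : ℝ × ℝ => (R (projIcc a b hab p.1) f', projIcc a b hab p.2) :=
      ((hRc f').comp (continuous_projIcc.comp continuous_fst)).prodMk
        (continuous_projIcc.comp continuous_snd)
    exact (continuous_fst.comp h1).eval (continuous_snd.comp h1)
  · have hp : projIcc a b hab ξ = ⟨ξ, hξ⟩ := projIcc_of_mem hab hξ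
    simp only [hp]
    rw [IccExtend_of_mem hab _ ht]
    exact congrArg (fun u : Icc a b →ᵇ (Fin n → ℂ) => u ⟨t, ht⟩) (hR ⟨ξ, hξ⟩ f')
  · have hM0 : 0 ≤ M := (norm_nonneg _).trans (hM a ⟨le_rfl, hab⟩)
    have hf' : ‖f'‖ ≤ M := (BoundedContinuousFunction.norm_le hM0).2 fun t => hM t t.2
    exact ((norm_extend_le hab _ t).trans (hRb _ _)).trans (mul_le_mul_of_nonneg_left hf' hC0)

end EvenKernel

/-! ### Duality with the transposed kernel -/

lemma dotProduct_intervalIntegral (v : Fin n → ℂ) {F : ℝ → Fin n → ℂ} {c d : ℝ}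
    (hF : IntervalIntegrable F volume c d) :
    v ⬝ᵥ (∫ s in c..d, F s) = ∫ s in c..d, v ⬝ᵥ F s := by
  have h := (∑ i, v i • ContinuousLinearMap.proj (R := ℂ) (φ := fun _ : Fin n => ℂ) i
    ).intervalIntegral_comp_comm hF
  simpa [dotProduct] using h.symm

lemma norm_dotProduct_le (v w : Fin n → ℂ) : ‖v ⬝ᵥ w‖ ≤ n * (‖v‖ * ‖w‖) := by
  calc ‖v ⬝ᵥ w‖ ≤ ∑ j, ‖v j * w j‖ := by rw [dotProduct]; exact norm_sum_le _ _
    _ ≤ ∑ _j : Fin n, ‖v‖ * ‖w‖ := by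
        refine Finset.sum_le_sum fun j _ => ?_
        rw [norm_mul]
        exact mul_le_mul (norm_le_pi_norm v j) (norm_le_pi_norm w j) (norm_nonneg _) (norm_nonneg _)
    _ = n * (‖v‖ * ‖w‖) := by simp

lemma continuous_dotProduct {u v : ℝ → Fin n → ℂ} (hu : Continuous u) (hv : Continuous v) :
    Continuous fun t => u t ⬝ᵥ v t := by
  simp only [dotProduct]; fun_prop

/-- A kernel `h(t - s) p(t) q(s)` with `h` integrable and `p`, `q` continuous is integrable on
rectangles. -/
lemma integrable_prod_sub {h : ℝ → ℂ} (hh : Integrable h) {p q : ℝ → ℂ} (hp : Continuous p)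
    (hq : Continuous q) (a ξ c η : ℝ) :
    Integrable (fun z : ℝ × ℝ => p z.1 * (h (z.1 - z.2) * q z.2))
      ((volume.restrict (Ioc a ξ)).prod (volume.restrict (Ioc c η))) := by
  have hq' : Integrable q (volume.restrict (Ioc c η)) :=
    (hq.integrableOn_Icc).mono_set Ioc_subset_Icc_self
  -- Without `p` this is the integrand of a convolution of integrable functions; `p` is bounded on
  -- the rectangle.
  have h1 := Integrable.convolution_integrand (ContinuousLinearMap.mul ℂ ℂ) (μ := volume) hq' hh
  have h2 : Integrable (fun z : ℝ × ℝ => h (z.1 - z.2) * q z.2)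
      ((volume.restrict (Ioc a ξ)).prod (volume.restrict (Ioc c η))) := by
    refine (h1.mono_measure (Measure.prod_mono Measure.restrict_le_self le_rfl)).congr ?_
    exact Eventually.of_forall fun z => by simp [mul_comm]
  obtain ⟨M, hM⟩ := isCompact_Icc.exists_bound_of_continuousOn (s := Icc a ξ) hp.continuousOn
  refine h2.bdd_mul (c := M) (hp.comp continuous_fst).aestronglyMeasurable ?_
  rw [Measure.prod_restrict]
  refine ae_restrict_of_forall_mem (measurableSet_Ioc.prod measurableSet_Ioc) fun z hz => ?_
  exact hM _ (Ioc_subset_Icc_self hz.1)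

namespace EvenKernel

variable {H : ℝ → Matrix (Fin n) (Fin n) ℂ} (hH : EvenKernel H) {a b : ℝ}
include hH

/-- The truncated convolutions with `H` and with its transpose are adjoint to each other. -/
lemma integral_dotProduct_convOp {ξ η : ℝ} (hξ : a ≤ ξ) (hη : a ≤ η) {χ u : ℝ → Fin n → ℂ}
    (hχ : Continuous χ) (hu : Continuous u) :
    ∫ t in a..ξ, χ t ⬝ᵥ convOp H a η u t =
      ∫ s in a..η, convOp (fun x => (H x)ᵀ) a ξ χ s ⬝ᵥ u s := by
  have h1 : ∀ t, χ t ⬝ᵥ convOp H a η u t = ∫ s in Ioc a η, χ t ⬝ᵥ (H (t - s) *ᵥ u s) := fun t => by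
    rw [convOp, dotProduct_intervalIntegral _ (hH.intervalIntegrable_mulVec hu t a η),
      intervalIntegral.integral_of_le hη]
  have h2 : ∀ s, convOp (fun x => (H x)ᵀ) a ξ χ s ⬝ᵥ u s =
      ∫ t in Ioc a ξ, χ t ⬝ᵥ (H (t - s) *ᵥ u s) := fun s => by
    rw [convOp, dotProduct_comm,
      dotProduct_intervalIntegral _ (hH.transpose.intervalIntegrable_mulVec hχ s a ξ),
      intervalIntegral.integral_of_le hξ]
    refine integral_congr_ae (Eventually.of_forall fun t => ?_)
    change u s ⬝ᵥ ((H (s - t))ᵀ *ᵥ χ t) = χ t ⬝ᵥ (H (t - s) *ᵥ u s)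
    rw [hH.sub_comm s t, Matrix.mulVec_transpose, dotProduct_comm, Matrix.dotProduct_mulVec]
  simp only [h1, h2]
  rw [intervalIntegral.integral_of_le hξ, intervalIntegral.integral_of_le hη]
  refine integral_integral_swap ?_
  have h3 : (Function.uncurry fun t s => χ t ⬝ᵥ (H (t - s) *ᵥ u s)) = fun z : ℝ × ℝ =>
      ∑ i, ∑ j, χ z.1 i * (H (z.1 - z.2) i j * u z.2 j) := by
    ext z
    simp only [Function.uncurry, dotProduct, Matrix.mulVec, Finset.mul_sum]
  rw [h3]
  refine integrable_finsetSum _ fun i _ => integrable_finsetSum _ fun j _ => ?_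
  exact integrable_prod_sub (hH.integrable i j) ((continuous_apply i).comp hχ)
    ((continuous_apply j).comp hu) _ _ _ _

/-- The pairing of `χ + χH` with `u` equals the pairing of `χ` with `u + Hu`. -/
lemma integral_dotProduct_add_convOp {ξ : ℝ} (hξ : a ≤ ξ) {χ u : ℝ → Fin n → ℂ}
    (hχ : Continuous χ) (hu : Continuous u) :
    ∫ t in a..ξ, χ t ⬝ᵥ (u t + convOp H a ξ u t) =
      ∫ s in a..ξ, (χ s + convOp (fun x => (H x)ᵀ) a ξ χ s) ⬝ᵥ u s := by
  simp only [dotProduct_add, add_dotProduct]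
  rw [intervalIntegral.integral_add, intervalIntegral.integral_add,
    hH.integral_dotProduct_convOp hξ hξ hχ hu]
  · exact (continuous_dotProduct hχ hu).intervalIntegrable _ _
  · exact (continuous_dotProduct (hH.transpose.continuous_convOp hξ hχ) hu).intervalIntegrable _ _
  · exact (continuous_dotProduct hχ hu).intervalIntegrable _ _
  · exact (continuous_dotProduct hχ (hH.continuous_convOp hξ hu)).intervalIntegrable _ _

/-- A homogeneous solution `ψ` of the transposed equation is orthogonal to the range of `1 + T_ξ`.
That range contains `star ψ`, so the integral of `∑ ‖ψ_i‖²` vanishes. -/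
lemma injectiveTruncations_transpose (hab : a ≤ b) (hinj : InjectiveTruncations H a b) :
    InjectiveTruncations (fun t => (H t)ᵀ) a b := by
  intro ξ hξ ψ hψ hψ0
  obtain ⟨C, -, hC⟩ := hH.exists_solution hab hinj
  obtain ⟨φ, hφc, hφ, -⟩ := hC (fun t => star (ψ t)) hψ.star
  have hφξ : Continuous (φ ξ) := hφc.comp (Continuous.prodMk_right ξ)
  have h1 := hH.integral_dotProduct_add_convOp hξ.1 hψ hφξ
  have h2 : ∫ s in a..ξ, (ψ s + convOp (fun x => (H x)ᵀ) a ξ ψ s) ⬝ᵥ φ ξ s = 0 := by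
    rw [intervalIntegral.integral_congr (g := fun _ => 0)]
    · simp
    · intro s hs
      rw [uIcc_of_le hξ.1] at hs
      simp [hψ0 s hs]
  have h3 : ∫ t in a..ξ, ψ t ⬝ᵥ (φ ξ t + convOp H a ξ (φ ξ) t) =
      ((∫ t in a..ξ, ∑ i, ‖ψ t i‖ ^ 2 : ℝ) : ℂ) := by
    rw [← intervalIntegral.integral_ofReal]
    refine intervalIntegral.integral_congr fun t ht => ?_
    rw [uIcc_of_le hξ.1] at ht
    simp only [hφ ξ hξ t ⟨ht.1, ht.2.trans hξ.2⟩]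
    simp [dotProduct, RCLike.mul_conj]
  rw [h2, h3] at h1
  have h4 : ∫ t in a..ξ, ∑ i, ‖ψ t i‖ ^ 2 = 0 := by exact_mod_cast h1
  intro t ht
  -- On a one-point interval the integral carries no information, but there the equation itself
  -- reads `ψ a = 0`.
  rcases hξ.1.eq_or_lt with rfl | hlt
  · have : t = a := le_antisymm ht.2 ht.1
    subst this
    simpa [convOp] using hψ0 t ht
  have hcont : Continuous fun t => ∑ i, ‖ψ t i‖ ^ 2 := by fun_prop
  by_contra hne
  have hpos : 0 < ∫ t in a..ξ, ∑ i, ‖ψ t i‖ ^ 2 := by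
    refine intervalIntegral.integral_pos hlt hcont.continuousOn (fun s _ => by positivity)
      ⟨t, ht, ?_⟩
    obtain ⟨i, hi⟩ := Function.ne_iff.1 hne
    refine Finset.sum_pos' (fun i _ => by positivity) ⟨i, Finset.mem_univ i, ?_⟩
    exact pow_pos (norm_pos_iff.2 hi) 2
  exact hpos.ne' h4

/-- A solution of a truncated equation is bounded in mean by the right-hand side. -/
theorem exists_integral_norm_le (hab : a ≤ b) (hinj : InjectiveTruncations H a b) :
    ∃ C : ℝ, 0 ≤ C ∧ ∀ ξ ∈ Icc a b, ∀ u : ℝ → Fin n → ℂ, Continuous u →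
      ∫ t in a..ξ, ‖u t‖ ≤ C * ∫ t in a..ξ, ‖u t + convOp H a ξ u t‖ := by
  obtain ⟨C, hC0, hC⟩ := hH.transpose.exists_solution hab (hH.injectiveTruncations_transpose hab hinj)
  -- One factor `n` bounds the dot product in the supremum norm, the other sums the coordinates.
  refine ⟨n * (n * C), by positivity, fun ξ hξ u hu => ?_⟩
  have hr : Continuous fun t => u t + convOp H a ξ u t := hu.add (hH.continuous_convOp hξ.1 hu)
  have hcoord : ∀ i, ∫ t in a..ξ, ‖u t i‖ ≤ n * C * ∫ t in a..ξ, ‖u t + convOp H a ξ u t‖ := by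
    intro i
    refine le_of_forall_pos_le_add fun ε hε => ?_
    have hba : 0 ≤ ξ - a := sub_nonneg.2 hξ.1
    set e : ℝ := ε / (ξ - a + 1) with he
    have he0 : 0 < e := by positivity
    have hui : Continuous fun t => u t i := (continuous_apply i).comp hu
    have hden : ∀ t, (((‖u t i‖ + e : ℝ)) : ℂ) ≠ 0 := fun t => by
      exact_mod_cast (by positivity : ‖u t i‖ + e ≠ 0)
    -- A continuous substitute for the conjugate sign of `u_i`. The term `e` keeps the quotient
    -- defined at zeros of `u_i` and costs at most `e` pointwise, hence at most `ε` after
    -- integration. Solving the transposed equation for `ψ` gives a bounded `χ`, and pairing it with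
    -- the equation for `u` gives the bound.
    let ψ : ℝ → Fin n → ℂ := fun t => Pi.single i (star (u t i) / ((‖u t i‖ + e : ℝ) : ℂ))
    have hψ : Continuous ψ := by
      refine (continuous_single i).comp ?_
      exact hui.star.div (Complex.continuous_ofReal.comp (hui.norm.add continuous_const)) hden
    have hψ1 : ∀ t ∈ Icc a b, ‖ψ t‖ ≤ 1 := fun t _ => by
      simp only [ψ, Pi.norm_single, norm_div, norm_star, Complex.norm_real, Real.norm_eq_abs]
      rw [abs_of_pos (by positivity), div_le_one (by positivity)]
      linarith
    obtain ⟨χ, hχc, hχ, hχb⟩ := hC ψ hψ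
    have hχξ : Continuous (χ ξ) := hχc.comp (Continuous.prodMk_right ξ)
    have h1 := hH.integral_dotProduct_add_convOp hξ.1 hχξ hu
    have h2 : ∫ s in a..ξ, (χ ξ s + convOp (fun x => (H x)ᵀ) a ξ (χ ξ) s) ⬝ᵥ u s =
        ((∫ s in a..ξ, ‖u s i‖ ^ 2 / (‖u s i‖ + e) : ℝ) : ℂ) := by
      rw [← intervalIntegral.integral_ofReal]
      refine intervalIntegral.integral_congr fun t ht => ?_
      rw [uIcc_of_le hξ.1] at ht
      simp only [hχ ξ hξ t ⟨ht.1, ht.2.trans hξ.2⟩]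
      simp only [ψ, single_dotProduct]
      rw [div_mul_eq_mul_div]
      simp [RCLike.conj_mul]
    rw [h2] at h1
    have h3 : ∫ s in a..ξ, ‖u s i‖ ^ 2 / (‖u s i‖ + e) ≤
        n * C * ∫ t in a..ξ, ‖u t + convOp H a ξ u t‖ := by
      calc ∫ s in a..ξ, ‖u s i‖ ^ 2 / (‖u s i‖ + e)
          ≤ ‖((∫ s in a..ξ, ‖u s i‖ ^ 2 / (‖u s i‖ + e) : ℝ) : ℂ)‖ := by
            rw [Complex.norm_real]; exact le_abs_self _
        _ ≤ ∫ t in a..ξ, n * C * ‖u t + convOp H a ξ u t‖ := by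
            rw [← h1]
            refine intervalIntegral.norm_integral_le_of_norm_le hξ.1
              (Eventually.of_forall fun t _ => (norm_dotProduct_le _ _).trans ?_)
              ((hr.norm.const_smul (n * C : ℝ)).intervalIntegrable _ _)
            rw [mul_assoc]
            have := hχb 1 hψ1 ξ t
            rw [mul_one] at this
            gcongr
        _ = _ := intervalIntegral.integral_const_mul _ _
    have h4 : ∫ t in a..ξ, ‖u t i‖ ≤ (∫ s in a..ξ, ‖u s i‖ ^ 2 / (‖u s i‖ + e)) + ε := by
      have hc1 : Continuous fun s => ‖u s i‖ ^ 2 / (‖u s i‖ + e) :=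
        (hui.norm.pow 2).div (hui.norm.add continuous_const) fun s => by positivity
      have h5 : ∫ t in a..ξ, ‖u t i‖ ≤ ∫ s in a..ξ, (‖u s i‖ ^ 2 / (‖u s i‖ + e) + e) := by
        refine intervalIntegral.integral_mono_on hξ.1 (hui.norm.intervalIntegrable _ _)
          ((hc1.add continuous_const).intervalIntegrable _ _) fun s _ => ?_
        have hx : 0 ≤ ‖u s i‖ := norm_nonneg _
        rw [← sub_le_iff_le_add, le_div_iff₀ (by positivity)]
        nlinarith
      rw [intervalIntegral.integral_add (hc1.intervalIntegrable _ _) intervalIntegrable_const,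
        intervalIntegral.integral_const, smul_eq_mul] at h5
      have h6 : (ξ - a) * e ≤ ε := by
        rw [he, mul_div_assoc', div_le_iff₀ (by positivity)]
        nlinarith
      linarith
    linarith
  calc ∫ t in a..ξ, ‖u t‖ ≤ ∫ t in a..ξ, ∑ i, ‖u t i‖ := by
        refine intervalIntegral.integral_mono_on hξ.1 (hu.norm.intervalIntegrable _ _)
          (Continuous.intervalIntegrable (by fun_prop) _ _) fun t _ => ?_
        exact (pi_norm_le_iff_of_nonneg (by positivity)).2 fun i =>
          Finset.single_le_sum (f := fun i => ‖u t i‖) (fun i _ => norm_nonneg _)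
            (Finset.mem_univ i)
    _ = ∑ i, ∫ t in a..ξ, ‖u t i‖ := intervalIntegral.integral_finsetSum fun i _ =>
        Continuous.intervalIntegrable (by fun_prop) _ _
    _ ≤ ∑ _i : Fin n, n * C * ∫ t in a..ξ, ‖u t + convOp H a ξ u t‖ :=
        Finset.sum_le_sum fun i _ => hcoord i
    _ = _ := by simp; ring

end EvenKernel

/-! ### Bounds for sums of solutions truncated at different points -/

/-- Indicators bring all the integrals to the common interval `[a, b]`. At a point `x`, only the
members whose interval reaches `x` are counted. -/
lemma sum_integral_le {a b : ℝ} (hab : a ≤ b) (s : Finset ℕ) {L : ℕ → ℝ}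
    (hL : ∀ i ∈ s, L i ∈ Icc a b) {F : ℕ → ℝ → ℝ}
    (hF : ∀ i ∈ s, IntervalIntegrable (F i) volume a b) {G : ℝ → ℝ}
    (hG : IntervalIntegrable G volume a b)
    (h : ∀ x ∈ Icc a b, ∑ i ∈ s with x ≤ L i, F i x ≤ G x) :
    ∑ i ∈ s, ∫ x in a..L i, F i x ≤ ∫ x in a..b, G x := by
  have hFi : ∀ i ∈ s, IntervalIntegrable (indicator {x | x ≤ L i} (F i)) volume a b := fun i hi => by
    have h1 := hF i hi
    rw [intervalIntegrable_iff] at h1 ⊢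
    exact Integrable.indicator h1 measurableSet_Iic
  calc ∑ i ∈ s, ∫ x in a..L i, F i x
      = ∑ i ∈ s, ∫ x in a..b, indicator {x | x ≤ L i} (F i) x :=
        Finset.sum_congr rfl fun i hi => (intervalIntegral.integral_indicator (hL i hi)).symm
    _ = ∫ x in a..b, ∑ i ∈ s, indicator {x | x ≤ L i} (F i) x :=
        (intervalIntegral.integral_finsetSum hFi).symm
    _ ≤ ∫ x in a..b, G x := by
        refine intervalIntegral.integral_mono_on hab ?_ hG fun x hx => ?_
        · have h2 := IntervalIntegrable.sum s hFi
          refine h2.congr fun x _ => ?_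
          simp
        · refine le_of_eq_of_le ?_ (h x hx)
          rw [Finset.sum_filter]
          rfl

/-- An integrable function is bounded up to a part of small integral. -/
lemma exists_integral_excess_le {k : ℝ → ℝ} (hk : Integrable k) (hk0 : ∀ x, 0 ≤ k x) {ε : ℝ}
    (hε : 0 < ε) :
    ∃ m : ℝ, 0 ≤ m ∧ Integrable (fun x => max (k x - m) 0) ∧ ∫ x, max (k x - m) 0 ≤ ε := by
  have hmeas : ∀ m : ℝ, AEStronglyMeasurable (fun x => max (k x - m) 0) volume := fun m =>
    (hk.aestronglyMeasurable.sub aestronglyMeasurable_const).sup aestronglyMeasurable_const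
  have hbound : ∀ m : ℝ, 0 ≤ m → ∀ x, ‖max (k x - m) 0‖ ≤ k x := fun m hm x => by
    rw [Real.norm_of_nonneg (le_max_right _ _)]
    exact max_le (by linarith) (hk0 x)
  -- At each point the excess over `m` is eventually zero, and it is dominated by `k`.
  have ht : Tendsto (fun m : ℕ => ∫ x, max (k x - m) 0) atTop (𝓝 (∫ _x : ℝ, (0 : ℝ))) := by
    refine tendsto_integral_of_dominated_convergence k (fun m => hmeas m) hk
      (fun m => Eventually.of_forall (hbound m m.cast_nonneg)) (Eventually.of_forall fun x => ?_)
    obtain ⟨N, hN⟩ := exists_nat_ge (k x)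
    refine tendsto_const_nhds.congr' ?_
    filter_upwards [eventually_ge_atTop N] with m hm
    have : (N : ℝ) ≤ m := by exact_mod_cast hm
    rw [max_eq_right (by linarith)]
  rw [integral_zero] at ht
  obtain ⟨m, hm⟩ := (ht.eventually (gt_mem_nhds hε)).exists
  exact ⟨m, m.cast_nonneg, hk.mono' (hmeas m) (Eventually.of_forall (hbound m m.cast_nonneg)), hm.le⟩

namespace EvenKernel

variable {H : ℝ → Matrix (Fin n) (Fin n) ℂ} (hH : EvenKernel H) {a b : ℝ}
include hH

/-- The inverses of the truncated operators are uniformly bounded on summable families, even if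
the members of the family are truncated at different points. -/
theorem exists_sum_norm_le (hab : a ≤ b) (hinj : InjectiveTruncations H a b) :
    ∃ C : ℝ, 0 ≤ C ∧ ∀ (s : Finset ℕ) (L : ℕ → ℝ), (∀ i ∈ s, L i ∈ Icc a b) →
      ∀ u : ℕ → ℝ → Fin n → ℂ, (∀ i ∈ s, Continuous (u i)) → ∀ B : ℝ,
      (∀ t ∈ Icc a b, ∑ i ∈ s with t ≤ L i, ‖u i t + convOp H a (L i) (u i) t‖ ≤ B) →
      ∀ t ∈ Icc a b, ∑ i ∈ s with t ≤ L i, ‖u i t‖ ≤ C * B := by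
  obtain ⟨C, hC0, hC⟩ := hH.exists_integral_norm_le hab hinj
  -- The kernel is split into a part bounded by `m`, handled by the bound in mean, and an excess of
  -- mass at most `1/2`, which contributes at most half the supremum of the sum and is absorbed on
  -- the left. This absorption is the factor `2` in the constant.
  obtain ⟨m, hm0, hkm, hm⟩ := exists_integral_excess_le hH.integrable_opBound
    (fun x => opBound_nonneg (H x)) (show (0 : ℝ) < 1 / 2 by norm_num)
  have hba : 0 ≤ b - a := sub_nonneg.2 hab
  refine ⟨2 * (1 + m * (C * (b - a))), by positivity, fun s L hL u hu B hB => ?_⟩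
  have hr : ∀ i ∈ s, Continuous fun t => u i t + convOp H a (L i) (u i) t := fun i hi =>
    (hu i hi).add (hH.continuous_convOp (hL i hi).1 (hu i hi))
  set S : ℝ → ℝ := fun t => ∑ i ∈ s with t ≤ L i, ‖u i t‖ with hS
  -- Finiteness of the supremum `N` is what permits absorbing `N / 2`.
  have hbdd : BddAbove (S '' Icc a b) := by
    have h1 : ∀ i ∈ s, ∃ M, ∀ t ∈ Icc a b, ‖u i t‖ ≤ M := fun i hi =>
      isCompact_Icc.exists_bound_of_continuousOn (hu i hi).continuousOn
    choose! M hM using h1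
    refine ⟨∑ i ∈ s, M i, ?_⟩
    rintro _ ⟨t, ht, rfl⟩
    exact (Finset.sum_le_sum_of_subset_of_nonneg (Finset.filter_subset _ _)
      fun i _ _ => norm_nonneg _).trans (Finset.sum_le_sum fun i hi => hM i hi t ht)
  set N : ℝ := sSup (S '' Icc a b) with hN
  have hSN : ∀ t ∈ Icc a b, S t ≤ N := fun t ht => le_csSup hbdd (mem_image_of_mem S ht)
  have hmean : ∑ i ∈ s, ∫ x in a..L i, ‖u i x‖ ≤ C * (b - a) * B := by
    calc ∑ i ∈ s, ∫ x in a..L i, ‖u i x‖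
        ≤ ∑ i ∈ s, C * ∫ x in a..L i, ‖u i x + convOp H a (L i) (u i) x‖ :=
          Finset.sum_le_sum fun i hi => hC (L i) (hL i hi) (u i) (hu i hi)
      _ = C * ∑ i ∈ s, ∫ x in a..L i, ‖u i x + convOp H a (L i) (u i) x‖ := by
          rw [Finset.mul_sum]
      _ ≤ C * ∫ _x in a..b, B := by
          refine mul_le_mul_of_nonneg_left ?_ hC0
          exact sum_integral_le hab s hL (fun i hi => (hr i hi).norm.intervalIntegrable _ _)
            intervalIntegrable_const hB
      _ = C * (b - a) * B := by rw [intervalIntegral.integral_const, smul_eq_mul]; ring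
  have hexc : ∀ t, ∀ c d, IntervalIntegrable (fun x => max (opBound (H (t - x)) - m) 0) volume c d :=
    fun t c d => (hkm.comp_sub_left t).intervalIntegrable
  have hstep : ∀ t ∈ Icc a b, S t ≤ (1 + m * (C * (b - a))) * B + N / 2 := by
    intro t ht
    have hN0 : 0 ≤ N := (Finset.sum_nonneg fun i _ => norm_nonneg _).trans (hSN t ht)
    have hpt : ∀ i ∈ s, ‖u i t‖ ≤ ‖u i t + convOp H a (L i) (u i) t‖ +
        ((m * ∫ x in a..L i, ‖u i x‖) +
          ∫ x in a..L i, max (opBound (H (t - x)) - m) 0 * ‖u i x‖) := by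
      intro i hi
      have h1 : ‖convOp H a (L i) (u i) t‖ ≤ (m * ∫ x in a..L i, ‖u i x‖) +
          ∫ x in a..L i, max (opBound (H (t - x)) - m) 0 * ‖u i x‖ := by
        refine (hH.norm_integral_mulVec_le (hu i hi) t (hL i hi).1).trans ?_
        rw [← intervalIntegral.integral_const_mul, ← intervalIntegral.integral_add
          (((hu i hi).norm.intervalIntegrable _ _).const_mul m)
          ((hexc t _ _).mul_continuousOn (hu i hi).norm.continuousOn)]
        refine intervalIntegral.integral_mono_on (hL i hi).1
          (hH.intervalIntegrable_opBound_mul (hu i hi).norm t _ _)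
          ((((hu i hi).norm.intervalIntegrable _ _).const_mul m).add
            ((hexc t _ _).mul_continuousOn (hu i hi).norm.continuousOn)) fun x _ => ?_
        rw [← add_mul]
        refine mul_le_mul_of_nonneg_right ?_ (norm_nonneg _)
        have := le_max_left (opBound (H (t - x)) - m) 0
        linarith
      have h2 : ‖u i t‖ ≤ ‖u i t + convOp H a (L i) (u i) t‖ + ‖convOp H a (L i) (u i) t‖ := by
        have := norm_sub_le (u i t + convOp H a (L i) (u i) t) (convOp H a (L i) (u i) t)
        rwa [add_sub_cancel_right] at this
      linarith
    have hexcess : ∑ i ∈ s, ∫ x in a..L i, max (opBound (H (t - x)) - m) 0 * ‖u i x‖ ≤ N / 2 := by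
      calc _ ≤ ∫ x in a..b, max (opBound (H (t - x)) - m) 0 * N := by
            refine sum_integral_le hab s hL
              (fun i hi => (hexc t _ _).mul_continuousOn (hu i hi).norm.continuousOn)
              ((hexc t _ _).mul_const N) fun x hx => ?_
            rw [← Finset.mul_sum]
            exact mul_le_mul_of_nonneg_left (hSN x hx) (le_max_right _ _)
        _ = (∫ x in a..b, max (opBound (H (t - x)) - m) 0) * N :=
            intervalIntegral.integral_mul_const _ _
        _ ≤ 1 / 2 * N := by
            refine mul_le_mul_of_nonneg_right (le_trans ?_ hm) hN0
            rw [intervalIntegral.integral_of_le hab,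
              ← integral_sub_left_eq_self (fun x => max (opBound (H x) - m) 0) _ t]
            exact setIntegral_le_integral (hkm.comp_sub_left t)
              (Eventually.of_forall fun _ => le_max_right _ _)
        _ = N / 2 := by ring
    have hI0 : ∀ i ∈ s, 0 ≤ (m * ∫ x in a..L i, ‖u i x‖) +
          ∫ x in a..L i, max (opBound (H (t - x)) - m) 0 * ‖u i x‖ := fun i hi =>
      add_nonneg (mul_nonneg hm0 (intervalIntegral.integral_nonneg (hL i hi).1
        fun _ _ => norm_nonneg _)) (intervalIntegral.integral_nonneg (hL i hi).1
        fun _ _ => mul_nonneg (le_max_right _ _) (norm_nonneg _))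
    calc S t ≤ ∑ i ∈ s with t ≤ L i, (‖u i t + convOp H a (L i) (u i) t‖ +
          ((m * ∫ x in a..L i, ‖u i x‖) +
            ∫ x in a..L i, max (opBound (H (t - x)) - m) 0 * ‖u i x‖)) :=
          Finset.sum_le_sum fun i hi => hpt i (Finset.mem_filter.1 hi).1
      _ ≤ B + ∑ i ∈ s, ((m * ∫ x in a..L i, ‖u i x‖) +
            ∫ x in a..L i, max (opBound (H (t - x)) - m) 0 * ‖u i x‖) := by
          rw [Finset.sum_add_distrib]
          exact add_le_add (hB t ht) (Finset.sum_le_sum_of_subset_of_nonneg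
            (Finset.filter_subset _ _) fun i hi _ => hI0 i hi)
      _ = B + (m * ∑ i ∈ s, ∫ x in a..L i, ‖u i x‖) +
            ∑ i ∈ s, ∫ x in a..L i, max (opBound (H (t - x)) - m) 0 * ‖u i x‖ := by
          rw [Finset.sum_add_distrib, Finset.mul_sum, add_assoc]
      _ ≤ B + m * (C * (b - a) * B) + N / 2 :=
          add_le_add (add_le_add le_rfl (mul_le_mul_of_nonneg_left hmean hm0)) hexcess
      _ = _ := by ring
  have hN2 : N ≤ (1 + m * (C * (b - a))) * B + N / 2 := by
    refine csSup_le ⟨S a, mem_image_of_mem S ⟨le_rfl, hab⟩⟩ ?_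
    rintro _ ⟨t, ht, rfl⟩
    exact hstep t ht
  intro t ht
  have := hSN t ht
  linarith

end EvenKernel

/-! ### Reflection and nonvanishing of the diagonal values -/

namespace EvenKernel

variable {H : ℝ → Matrix (Fin n) (Fin n) ℂ} (hH : EvenKernel H) {a b : ℝ}
include hH

lemma integral_reflect (w : ℝ → Fin n → ℂ) (c d e t : ℝ) :
    ∫ s in c..d, H (t - s) *ᵥ w (e - s) = ∫ s in (e - d)..(e - c), H (e - t - s) *ᵥ w s := by
  rw [← intervalIntegral.integral_comp_sub_left (fun x => H (e - t - x) *ᵥ w x) e]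
  refine intervalIntegral.integral_congr fun s _ => ?_
  rw [show e - t - (e - s) = s - t by ring, hH.sub_comm]

/-- This is where evenness acts: the reflection exchanging `a` and `ξ` turns `H (t - s)` into `H (s
- t)`. -/
lemma convOp_reflect (w : ℝ → Fin n → ℂ) (ξ t : ℝ) :
    convOp H a ξ (fun s => w (ξ + a - s)) t = convOp H a ξ w (ξ + a - t) := by
  unfold convOp
  rw [hH.integral_reflect w a ξ (ξ + a) t]
  congr 1 <;> ring

lemma eqOn_of_solves (hinj : InjectiveTruncations H a b) {ξ : ℝ} (hξ : ξ ∈ Icc a b)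
    {u v : ℝ → Fin n → ℂ} (hu : Continuous u) (hv : Continuous v)
    (h : ∀ t ∈ Icc a ξ, u t + convOp H a ξ u t = v t + convOp H a ξ v t) :
    EqOn u v (Icc a ξ) := by
  intro t ht
  have := hinj ξ hξ (fun s => u s - v s) (hu.sub hv) (fun t ht => by
    rw [hH.convOp_sub hu hv, sub_add_sub_comm, h t ht, sub_self]) t ht
  exact sub_eq_zero.1 this

/-- The equation satisfied by the difference of two reflected truncated solutions. -/
lemma add_convOp_reflect_sub {α β : ℝ} (hαβ : α ≤ β) {f u v : ℝ → Fin n → ℂ}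
    (hu : Continuous u) (hv : Continuous v)
    (hfu : ∀ t ∈ Icc a β, u t + convOp H a β u t = f t)
    (hfv : ∀ t ∈ Icc a α, v t + convOp H a α v t = f t) {t : ℝ} (ht : t ∈ Icc a α) :
    u (β + a - t) - v (α + a - t) + convOp H a α (fun s => u (β + a - s) - v (α + a - s)) t =
      f (β + a - t) - f (α + a - t) -
        ∫ s in a..(a + (β - α)), H (β + a - t - s) *ᵥ u s := by
  have hu' : Continuous fun s => u (β + a - s) := hu.comp (continuous_const.sub continuous_id)
  have hv' : Continuous fun s => v (α + a - s) := hv.comp (continuous_const.sub continuous_id)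
  have h1 : convOp H a α (fun s => u (β + a - s)) t =
      convOp H a β u (β + a - t) - ∫ s in a..(a + (β - α)), H (β + a - t - s) *ᵥ u s := by
    have h2 := hH.convOp_split hu a (a + (β - α)) β (β + a - t)
    rw [h2]
    unfold convOp
    rw [hH.integral_reflect u a α (β + a) t, show β + a - α = a + (β - α) by ring,
      show β + a - a = β by ring]
    abel
  rw [hH.convOp_sub hu' hv', hH.convOp_reflect v α t, h1,
    ← hfu (β + a - t) ⟨by linarith [ht.2], by linarith [ht.1]⟩,
    ← hfv (α + a - t) ⟨by linarith [ht.2], by linarith [ht.1]⟩]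
  abel

lemma integral_opBound_reflect (c d t : ℝ) :
    ∫ s in a..(a + (d - c)), opBound (H (d + a - t - s)) = ∫ s in c..d, opBound (H (t - s)) := by
  rw [intervalIntegral.integral_comp_sub_left (fun x => opBound (H x)) (d + a - t)]
  have h1 : ∫ s in c..d, opBound (H (t - s)) = ∫ s in c..d, opBound (H (s - t)) :=
    intervalIntegral.integral_congr fun s _ => by simp only [hH.sub_comm t s]
  rw [h1, intervalIntegral.integral_comp_sub_right (fun x => opBound (H x)) t]
  congr 1 <;> ring

/-- A bound for the sum of the increments of the diagonal values `φ(ξ, ξ)` of truncated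
solutions. -/
theorem exists_sum_diagonal_sub_le (hab : a ≤ b) (hinj : InjectiveTruncations H a b) :
    ∃ C : ℝ, 0 ≤ C ∧ ∀ (s : Finset ℕ) (α β : ℕ → ℝ), (∀ i ∈ s, α i ∈ Icc a b) →
      (∀ i ∈ s, α i ≤ β i) → ∀ f u v : ℕ → ℝ → Fin n → ℂ,
      (∀ i ∈ s, Continuous (u i)) → (∀ i ∈ s, Continuous (v i)) →
      (∀ i ∈ s, ∀ t ∈ Icc a (β i), u i t + convOp H a (β i) (u i) t = f i t) →
      (∀ i ∈ s, ∀ t ∈ Icc a (α i), v i t + convOp H a (α i) (v i) t = f i t) →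
      ∀ m : ℕ → ℝ, (∀ i ∈ s, ∀ x ∈ Icc a (a + (β i - α i)), ‖u i x‖ ≤ m i) → ∀ B : ℝ,
      (∀ t ∈ Icc a b, ∑ i ∈ s with t ≤ α i, (‖f i (β i + a - t) - f i (α i + a - t)‖ +
        m i * ∫ x in (α i)..(β i), opBound (H (t - x))) ≤ B) →
      ∑ i ∈ s, ‖u i (β i) - v i (α i)‖ ≤ C * B := by
  obtain ⟨C, hC0, hC⟩ := hH.exists_sum_norm_le hab hinj
  refine ⟨C, hC0, fun s α β hα hαβ f u v hu hv hfu hfv m hm B hB => ?_⟩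
  -- After reflection the values `u (β)` and `v (α)` both sit at the common endpoint `a`. The
  -- differences solve equations truncated at `α i`, and the bound on sums is evaluated at `a`,
  -- where no member is filtered out.
  have h1 := hC s α hα (fun i t => u i (β i + a - t) - v i (α i + a - t))
    (fun i hi => ((hu i hi).comp (continuous_const.sub continuous_id)).sub
      ((hv i hi).comp (continuous_const.sub continuous_id))) B (fun t ht => by
      refine le_trans (Finset.sum_le_sum fun i hi => ?_) (hB t ht)
      obtain ⟨hi, hti⟩ := Finset.mem_filter.1 hi
      rw [hH.add_convOp_reflect_sub (hαβ i hi) (hu i hi) (hv i hi) (hfu i hi) (hfv i hi)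
        ⟨ht.1, hti⟩]
      refine (norm_sub_le _ _).trans (add_le_add le_rfl ?_)
      rw [← hH.integral_opBound_reflect (a := a)]
      exact hH.norm_integral_mulVec_le_mul (hu i hi) _ (by linarith [hαβ i hi]) (hm i hi))
    a ⟨le_rfl, hab⟩
  rw [Finset.filter_true_of_mem fun i hi => (hα i hi).1] at h1
  simpa using h1

omit hH in
lemma convOp_self (u : ℝ → Fin n → ℂ) (t : ℝ) : convOp H a a u t = 0 := by
  simp [convOp]

/-- If the truncated solutions with a constant right-hand side have a vanishing diagonal value at
some point, then the diagonal values vanish on an interval of fixed length to its left. -/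
lemma exists_diagonal_eq_zero (hab : a ≤ b) (hinj : InjectiveTruncations H a b) {c : Fin n → ℂ}
    {φ : ℝ → ℝ → Fin n → ℂ} (hφc : Continuous fun p : ℝ × ℝ => φ p.1 p.2)
    (hφ : ∀ ξ ∈ Icc a b, ∀ t ∈ Icc a ξ, φ ξ t + convOp H a ξ (φ ξ) t = c) :
    ∃ δ > 0, ∀ η ∈ Icc a b, φ η η = 0 → ∀ ξ ∈ Icc a η, η - ξ < δ → φ ξ ξ = 0 := by
  obtain ⟨C, hC0, hC⟩ := hH.exists_sum_diagonal_sub_le hab hinj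
  -- The constant makes `C` times the kernel mass over an interval shorter than `δ` at most `1/2`.
  obtain ⟨δ, hδ, hδk⟩ := hH.exists_integral_opBound_le (show 0 < 1 / (2 * (C + 1)) by positivity) a b
  have hφξ : ∀ ξ, Continuous (φ ξ) := fun ξ => hφc.comp (Continuous.prodMk_right ξ)
  have hz : Continuous fun ξ => φ ξ ξ := hφc.comp (continuous_id.prodMk continuous_id)
  -- A constant right-hand side is invariant under reflection, hence so is the solution. Its values
  -- near `a` are therefore close to its diagonal value.
  have hsymm : ∀ ξ ∈ Icc a b, ∀ t ∈ Icc a ξ, φ ξ (ξ + a - t) = φ ξ t := fun ξ hξ => by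
    refine hH.eqOn_of_solves hinj hξ ((hφξ ξ).comp (continuous_const.sub continuous_id)) (hφξ ξ)
      fun t ht => ?_
    have ht' : ξ + a - t ∈ Icc a ξ := ⟨by linarith [ht.2], by linarith [ht.1]⟩
    rw [hφ ξ hξ t ht, ← hφ ξ hξ _ ht', hH.convOp_reflect]
  have huc := (isCompact_Icc.prod isCompact_Icc : IsCompact (Icc a b ×ˢ Icc a b)
    ).uniformContinuousOn_of_continuous hφc.continuousOn
  refine ⟨δ, hδ, fun η hη hη0 ξ hξ hξδ => ?_⟩
  -- At a maximum point `ζ` of the diagonal norm, telescoping up to `η`, where the diagonal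
  -- vanishes, bounds `‖φ ζ ζ‖` by `(‖φ ζ ζ‖ + ε) / 2`. The partition is fine enough that the
  -- solutions near `a` exceed the maximal diagonal norm by at most `ε`.
  obtain ⟨ζ, hζ, hmax⟩ := (isCompact_Icc (a := ξ) (b := η)).exists_isMaxOn ⟨ξ, le_rfl, hξ.2⟩
    hz.norm.continuousOn
  have hsub : Icc ζ η ⊆ Icc a b := Icc_subset_Icc (hξ.1.trans hζ.1) hη.2
  have hkey : ∀ ε > 0, ‖φ ζ ζ‖ ≤ (‖φ ζ ζ‖ + ε) / 2 := by
    intro ε hε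
    obtain ⟨ρ, hρ, hρφ⟩ := Metric.uniformContinuousOn_iff.1 huc ε hε
    obtain ⟨N, hN⟩ := exists_nat_gt ((η - ζ) / ρ)
    have hηζ : 0 ≤ η - ζ := sub_nonneg.2 hζ.2
    have hN0 : (0 : ℝ) < N := lt_of_le_of_lt (by positivity) hN
    set x : ℕ → ℝ := fun i => ζ + i * ((η - ζ) / N) with hx
    have hx0 : x 0 = ζ := by simp [hx]
    have hxN : x N = η := by simp only [hx]; field_simp; ring
    have hxs : ∀ i, x (i + 1) - x i = (η - ζ) / N := fun i => by simp only [hx]; push_cast; ring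
    have hxm : Monotone x := monotone_nat_of_le_succ fun i => by
      have : 0 ≤ (η - ζ) / N := by positivity
      linarith [hxs i]
    have hmesh : (η - ζ) / N < ρ := by
      rw [div_lt_iff₀ hρ] at hN
      rw [div_lt_iff₀ hN0]; linarith
    have hmem : ∀ i ≤ N, x i ∈ Icc ζ η := fun i hi =>
      ⟨hx0 ▸ hxm (Nat.zero_le i), hxN ▸ hxm hi⟩
    have hI : ∀ t c d, IntervalIntegrable (fun s => opBound (H (t - s))) volume c d :=
      hH.intervalIntegrable_opBound
    have h1 := hC (Finset.range N) x (fun i => x (i + 1))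
      (fun i hi => hsub (hmem i (Finset.mem_range.1 hi).le))
      (fun i _ => hxm (Nat.le_succ i)) (fun _ _ => c) (fun i => φ (x (i + 1))) (fun i => φ (x i))
      (fun i _ => hφξ _) (fun i _ => hφξ _)
      (fun i hi => hφ _ (hsub (hmem (i + 1) (Finset.mem_range.1 hi))))
      (fun i hi => hφ _ (hsub (hmem i (Finset.mem_range.1 hi).le)))
      (fun _ => ‖φ ζ ζ‖ + ε) (fun i hi y hy => by
        have hmi := hmem (i + 1) (Finset.mem_range.1 hi)
        have hmi' := hmem i (Finset.mem_range.1 hi).le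
        have hb := hsub hmi
        have hb' := hsub hmi'
        have hy' : y ∈ Icc a (x (i + 1)) := ⟨hy.1, by linarith [hy.2, hb'.1]⟩
        rw [← hsymm _ hb y hy']
        have hd : dist (φ (x (i + 1)) (x (i + 1) + a - y)) (φ (x (i + 1)) (x (i + 1))) < ε := by
          refine hρφ (x (i + 1), x (i + 1) + a - y)
            ⟨hb, by linarith [hy'.2], by linarith [hy'.1, hb.2]⟩ (x (i + 1), x (i + 1)) ⟨hb, hb⟩ ?_
          rw [Prod.dist_eq, dist_self, Real.dist_eq,
            show x (i + 1) + a - y - x (i + 1) = -(y - a) by ring, abs_neg,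
            abs_of_nonneg (by linarith [hy.1])]
          refine max_lt hρ ?_
          linarith [hy.2, hxs i]
        rw [dist_eq_norm] at hd
        have h2 := norm_le_norm_add_norm_sub' (φ (x (i + 1)) (x (i + 1) + a - y))
          (φ (x (i + 1)) (x (i + 1)))
        have h3 : ‖φ (x (i + 1)) (x (i + 1))‖ ≤ ‖φ ζ ζ‖ :=
          hmax ⟨hζ.1.trans hmi.1, hmi.2⟩
        linarith)
      ((‖φ ζ ζ‖ + ε) * (1 / (2 * (C + 1)))) (fun t ht => by
        simp only [sub_self, norm_zero, zero_add]
        rw [← Finset.mul_sum]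
        refine mul_le_mul_of_nonneg_left ?_ (by positivity)
        refine (Finset.sum_le_sum_of_subset_of_nonneg (Finset.filter_subset _ _)
          fun i _ _ => intervalIntegral.integral_nonneg (hxm (Nat.le_succ i))
            fun _ _ => opBound_nonneg _).trans ?_
        rw [intervalIntegral.sum_integral_adjacent_intervals fun i _ => hI t _ _, hx0, hxN]
        exact hδk t ht ζ (hsub ⟨le_rfl, hζ.2⟩) η hη hζ.2 (by linarith [hζ.1]))
    have h2 : ‖φ ζ ζ‖ ≤ ∑ i ∈ Finset.range N, ‖φ (x (i + 1)) (x (i + 1)) - φ (x i) (x i)‖ := by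
      refine le_trans ?_ (norm_sum_le _ _)
      rw [Finset.sum_range_sub (fun i => φ (x i) (x i)), hx0, hxN, hη0, zero_sub, norm_neg]
    refine (h2.trans h1).trans ?_
    have h3 : C * (1 / (2 * (C + 1))) ≤ 1 / 2 := by
      rw [mul_one_div, div_le_div_iff₀ (by positivity) (by norm_num)]
      linarith
    have h4 : 0 ≤ ‖φ ζ ζ‖ + ε := by positivity
    nlinarith
  have hζ0 : ‖φ ζ ζ‖ ≤ 0 := by
    refine le_of_forall_pos_le_add fun ε hε => ?_
    have := hkey ε hε
    linarith
  have h5 : ‖φ ξ ξ‖ ≤ ‖φ ζ ζ‖ := hmax ⟨le_rfl, hξ.2⟩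
  exact norm_le_zero_iff.1 (h5.trans hζ0)

/-- The diagonal values of the truncated solutions with a nonzero constant right-hand side do not
vanish. -/
theorem diagonal_ne_zero (hab : a ≤ b) (hinj : InjectiveTruncations H a b) {c : Fin n → ℂ}
    (hc : c ≠ 0) {φ : ℝ → ℝ → Fin n → ℂ} (hφc : Continuous fun p : ℝ × ℝ => φ p.1 p.2)
    (hφ : ∀ ξ ∈ Icc a b, ∀ t ∈ Icc a ξ, φ ξ t + convOp H a ξ (φ ξ) t = c) :
    ∀ ξ ∈ Icc a b, φ ξ ξ ≠ 0 := by
  obtain ⟨δ, hδ, h⟩ := hH.exists_diagonal_eq_zero hab hinj hφc hφ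
  have hz : Continuous fun ξ => φ ξ ξ := hφc.comp (continuous_id.prodMk continuous_id)
  intro ξ hξ hξ0
  have hcomp : IsCompact (Icc a b ∩ {ξ | φ ξ ξ = 0}) :=
    isCompact_Icc.inter_right (isClosed_eq hz continuous_const)
  -- The leftmost zero lies to the right of `a`, where the diagonal value is `c`; the zeros just to
  -- its left then contradict minimality.
  obtain ⟨η, ⟨hη, hη0⟩, hmin⟩ := hcomp.exists_isLeast ⟨ξ, hξ, hξ0⟩
  have haη : a < η := by
    refine lt_of_le_of_ne hη.1 fun heq => hc ?_
    subst heq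
    have := hφ a hη a ⟨le_rfl, le_rfl⟩
    rw [convOp_self, add_zero] at this
    rw [← this]; exact hη0
  have hζ : max a (η - δ / 2) ∈ Icc a η := ⟨le_max_left _ _, max_le hη.1 (by linarith)⟩
  have h1 := h η hη hη0 _ hζ (by have := le_max_right a (η - δ / 2); linarith)
  have h2 : η ≤ max a (η - δ / 2) := hmin ⟨⟨hζ.1, hζ.2.trans hη.2⟩, h1⟩
  rcases le_max_iff.1 h2 with h3 | h3 <;> linarith

end EvenKernel

/-! ### Derivatives of the moments -/

/-- Differentiation of an integral whose integrand and upper limit depend on the parameter. -/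
lemma hasDerivWithinAt_of_sub_eq_integral {Φ : ℝ → ℂ} {K : ℝ → ℝ → ℂ}
    (hK : Continuous fun p : ℝ × ℝ => K p.1 p.2) {S : Set ℝ} {ξ : ℝ}
    (h : ∀ η ∈ S, Φ η - Φ ξ = ∫ s in ξ..η, K η s) :
    HasDerivWithinAt Φ (K ξ ξ) S ξ := by
  rw [hasDerivWithinAt_iff_isLittleO, Asymptotics.isLittleO_iff]
  intro ε hε
  obtain ⟨δ, hδ, hKδ⟩ := Metric.continuousAt_iff.1 (hK.continuousAt (x := (ξ, ξ))) ε hε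
  filter_upwards [inter_mem_nhdsWithin S (Metric.ball_mem_nhds ξ hδ)] with η hη
  have hKη : Continuous (K η) := hK.comp (Continuous.prodMk_right η)
  have h1 : Φ η - Φ ξ - (η - ξ) • K ξ ξ = ∫ s in ξ..η, (K η s - K ξ ξ) := by
    rw [intervalIntegral.integral_sub (hKη.intervalIntegrable _ _) intervalIntegrable_const,
      intervalIntegral.integral_const, h η hη.1]
  rw [h1, Real.norm_eq_abs]
  refine intervalIntegral.norm_integral_le_of_norm_le_const fun s hs => ?_
  have hη2 : |η - ξ| < δ := by rw [← Real.dist_eq]; exact hη.2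
  have hs2 : |s - ξ| ≤ |η - ξ| := abs_sub_left_of_mem_uIcc (uIoc_subset_uIcc hs)
  have h2 := @hKδ (η, s) (by
    rw [Prod.dist_eq, Real.dist_eq, Real.dist_eq]
    exact max_lt hη2 (hs2.trans_lt hη2))
  rw [dist_eq_norm] at h2
  exact h2.le

lemma continuous_mulVec_comp {X : Type*} [TopologicalSpace X] {A : X → Matrix (Fin n) (Fin n) ℂ}
    {v : X → Fin n → ℂ} (hA : Continuous A) (hv : Continuous v) :
    Continuous fun x => A x *ᵥ v x :=
  hA.matrix_mulVec hv

lemma continuous_opBound : Continuous (opBound : Matrix (Fin n) (Fin n) ℂ → ℝ) := by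
  unfold opBound
  refine continuous_const.mul (Continuous.norm ?_)
  exact continuous_pi fun i => continuous_pi fun j => continuous_id.matrix_elem i j

lemma continuousOn_inv {A : ℝ → Matrix (Fin n) (Fin n) ℂ} {S : Set ℝ} (hA : ContinuousOn A S)
    (hdet : ∀ x ∈ S, (A x).det ≠ 0) : ContinuousOn (fun x => (A x)⁻¹) S := by
  have h1 : ContinuousOn (fun x => (A x).det) S :=
    (continuous_id.matrix_det).comp_continuousOn hA
  have h2 : ContinuousOn (fun x => (A x).adjugate) S :=
    (continuous_id.matrix_adjugate).comp_continuousOn hA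
  simp only [Matrix.inv_def, Ring.inverse_eq_inv']
  exact (h1.inv₀ hdet).smul h2

/-- Abel summation with `N + 2` nodes for `A` and `N + 1` for `F`: in a Stieltjes sum, the tags
together with both endpoints become the nodes of a dual partition. -/
lemma sum_sub_mulVec_by_parts (A : ℕ → Matrix (Fin n) (Fin n) ℂ) (F : ℕ → Fin n → ℂ) (N : ℕ) :
    ∑ i ∈ Finset.range (N + 1), (A (i + 1) - A i) *ᵥ F i +
      ∑ i ∈ Finset.range N, A (i + 1) *ᵥ (F (i + 1) - F i) = A (N + 1) *ᵥ F N - A 0 *ᵥ F 0 := by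
  induction N with
  | zero => simp [Matrix.sub_mulVec]
  | succ N ih =>
    rw [Finset.sum_range_succ _ (N + 1),
      Finset.sum_range_succ (fun i => A (i + 1) *ᵥ (F (i + 1) - F i)), add_add_add_comm, ih]
    simp only [Matrix.sub_mulVec, Matrix.mulVec_sub]
    abel

namespace EvenKernel

variable {H : ℝ → Matrix (Fin n) (Fin n) ℂ} (hH : EvenKernel H) {a b : ℝ}
include hH

section Moment

variable {c : Fin n → ℂ} {f : ℝ → Fin n → ℂ} {χ φ : ℝ → ℝ → Fin n → ℂ}
  (hχc : Continuous fun p : ℝ × ℝ => χ p.1 p.2) (hφc : Continuous fun p : ℝ × ℝ => φ p.1 p.2)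
  (hχ : ∀ ξ ∈ Icc a b, ∀ t ∈ Icc a b, χ ξ t + convOp (fun x => (H x)ᵀ) a ξ (χ ξ) t = c)
  (hφ : ∀ ξ ∈ Icc a b, ∀ t ∈ Icc a b, φ ξ t + convOp H a ξ (φ ξ) t = f t)
include hχc hφc hχ hφ

/-- Testing the equation truncated at `η` against the dual solution truncated at `ξ`, adjointness
cancels everything except the integral of `χ_ξ · φ_η` between the two truncation points. -/
lemma integral_dotProduct_eq_sub {ξ η : ℝ} (hξ : ξ ∈ Icc a b) (hη : η ∈ Icc a b) :
    ∫ s in a..ξ, χ ξ s ⬝ᵥ f s =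
      (∫ s in a..η, c ⬝ᵥ φ η s) - ∫ s in ξ..η, χ ξ s ⬝ᵥ φ η s := by
  have hχξ : Continuous (χ ξ) := hχc.comp (Continuous.prodMk_right ξ)
  have hφη : Continuous (φ η) := hφc.comp (Continuous.prodMk_right η)
  have hI : ∀ x y, IntervalIntegrable (fun s => χ ξ s ⬝ᵥ φ η s) volume x y := fun x y =>
    (continuous_dotProduct hχξ hφη).intervalIntegrable _ _
  have h1 : ∫ s in a..ξ, χ ξ s ⬝ᵥ f s =
      (∫ s in a..ξ, χ ξ s ⬝ᵥ φ η s) + ∫ s in a..ξ, χ ξ s ⬝ᵥ convOp H a η (φ η) s := by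
    rw [← intervalIntegral.integral_add (hI _ _)
      ((continuous_dotProduct hχξ (hH.continuous_convOp hη.1 hφη)).intervalIntegrable _ _)]
    refine intervalIntegral.integral_congr fun s hs => ?_
    rw [uIcc_of_le hξ.1] at hs
    simp only [← dotProduct_add, hφ η hη s ⟨hs.1, hs.2.trans hξ.2⟩]
  have h2 : ∫ s in a..η, convOp (fun x => (H x)ᵀ) a ξ (χ ξ) s ⬝ᵥ φ η s =
      (∫ s in a..η, c ⬝ᵥ φ η s) - ∫ s in a..η, χ ξ s ⬝ᵥ φ η s := by
    rw [← intervalIntegral.integral_sub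
      ((continuous_dotProduct continuous_const hφη).intervalIntegrable _ _) (hI _ _)]
    refine intervalIntegral.integral_congr fun s hs => ?_
    rw [uIcc_of_le hη.1] at hs
    simp only [← sub_dotProduct, ← hχ ξ hξ s ⟨hs.1, hs.2.trans hη.2⟩, add_sub_cancel_left]
  rw [h1, hH.integral_dotProduct_convOp hξ.1 hη.1 hχξ hφη, h2,
    ← intervalIntegral.integral_add_adjacent_intervals (hI a ξ) (hI ξ η)]
  abel

lemma integral_dotProduct_eq {ξ : ℝ} (hξ : ξ ∈ Icc a b) :
    ∫ s in a..ξ, χ ξ s ⬝ᵥ f s = ∫ s in a..ξ, c ⬝ᵥ φ ξ s := by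
  rw [hH.integral_dotProduct_eq_sub hχc hφc hχ hφ hξ hξ, intervalIntegral.integral_same, sub_zero]

/-- The increment of the moment is exactly `∫_ξ^η χ_ξ · φ_η`, so continuity of the solutions
suffices; they are not differentiated in the truncation point. -/
lemma hasDerivWithinAt_integral_dotProduct {ξ : ℝ} (hξ : ξ ∈ Icc a b) :
    HasDerivWithinAt (fun η => ∫ s in a..η, χ η s ⬝ᵥ f s) (χ ξ ξ ⬝ᵥ φ ξ ξ) (Icc a b) ξ := by
  refine hasDerivWithinAt_of_sub_eq_integral (K := fun η s => χ ξ s ⬝ᵥ φ η s) ?_ fun η hη => ?_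
  · have h1 : Continuous fun p : ℝ × ℝ => χ ξ p.2 :=
      hχc.comp (continuous_const.prodMk continuous_snd)
    simp only [dotProduct]
    fun_prop
  · rw [hH.integral_dotProduct_eq hχc hφc hχ hφ hη,
      hH.integral_dotProduct_eq_sub hχc hφc hχ hφ hξ hη]
    abel

end Moment

/-! ### The Stieltjes representation -/

section Increment

variable {G : ℝ → ℝ → Matrix (Fin n) (Fin n) ℂ} {f : ℝ → Fin n → ℂ} {φ : ℝ → ℝ → Fin n → ℂ}
  (hGc : Continuous fun p : ℝ × ℝ => G p.1 p.2) (hφc : Continuous fun p : ℝ × ℝ => φ p.1 p.2)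
  (hG : ∀ c : Fin n → ℂ, ∀ ξ ∈ Icc a b, ∀ t ∈ Icc a b,
    G ξ t *ᵥ c + convOp H a ξ (fun s => G ξ s *ᵥ c) t = c)
  (hφ : ∀ ξ ∈ Icc a b, ∀ t ∈ Icc a b, φ ξ t + convOp H a ξ (φ ξ) t = f t)
include hGc hφc hG hφ

omit hG hφ hH in
lemma continuous_sub_mulVec (ξ : ℝ) (c : Fin n → ℂ) :
    Continuous fun s => φ ξ s - G ξ s *ᵥ c :=
  (hφc.comp (Continuous.prodMk_right ξ)).sub
    (continuous_mulVec_comp (hGc.comp (Continuous.prodMk_right ξ)) continuous_const)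

/-- Subtracting `G c` shifts the right-hand side by the constant `c`, leaving `c` free to make a
chosen diagonal value vanish. -/
lemma sub_mulVec_add_convOp (c : Fin n → ℂ) {ξ t : ℝ} (hξ : ξ ∈ Icc a b) (ht : t ∈ Icc a b) :
    φ ξ t - G ξ t *ᵥ c + convOp H a ξ (fun s => φ ξ s - G ξ s *ᵥ c) t = f t - c := by
  have hφξ : Continuous (φ ξ) := hφc.comp (Continuous.prodMk_right ξ)
  have hGξ : Continuous (G ξ) := hGc.comp (Continuous.prodMk_right ξ)
  rw [hH.convOp_sub hφξ (continuous_mulVec_comp hGξ continuous_const), ← hφ ξ hξ t ht]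
  conv_rhs => rw [← hG c ξ hξ t ht]
  abel

/-- The equation satisfied by the increment of `φ(ξ, ·) - G(ξ, ·) c` in the truncation point. -/
lemma increment_add_convOp (c : Fin n → ℂ) {α β t : ℝ} (hα : α ∈ Icc a b) (hβ : β ∈ Icc a b)
    (ht : t ∈ Icc a b) :
    (φ β t - G β t *ᵥ c) - (φ α t - G α t *ᵥ c) +
      convOp H a α (fun s => (φ β s - G β s *ᵥ c) - (φ α s - G α s *ᵥ c)) t =
      -∫ s in α..β, H (t - s) *ᵥ (φ β s - G β s *ᵥ c) := by
  have hcβ := continuous_sub_mulVec hGc hφc β c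
  have hcα := continuous_sub_mulVec hGc hφc α c
  have h1 := hH.sub_mulVec_add_convOp hGc hφc hG hφ c hβ ht
  have h2 := hH.sub_mulVec_add_convOp hGc hφc hG hφ c hα ht
  rw [hH.convOp_split hcβ a α β t] at h1
  rw [hH.convOp_sub hcβ hcα]
  rw [← h2] at h1
  rw [eq_neg_iff_add_eq_zero, ← sub_eq_zero.2 h1]
  abel

/-- The Stieltjes representation of the solution. -/
theorem hasStieltjesIntegral (hab : a ≤ b) (hinj : InjectiveTruncations H a b)
    {F : ℝ → Fin n → ℂ} (hF : ContinuousOn F (Icc a b))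
    (hFd : ∀ ξ ∈ Icc a b, φ ξ ξ = G ξ ξ *ᵥ F ξ) {A : ℝ → Matrix (Fin n) (Fin n) ℂ} {t : ℝ}
    (ht : t ∈ Icc a b) (hA : ∀ ξ ∈ Icc t b, A ξ = G ξ t) :
    HasStieltjesIntegral A F t b (G b t *ᵥ F b - φ b t) := by
  obtain ⟨C, hC0, hC⟩ := hH.exists_sum_norm_le hab hinj
  intro ε hε
  set κ : ℝ := ∫ x, opBound (H x) with hκ
  have hκ0 : 0 ≤ κ := integral_nonneg fun _ => opBound_nonneg _
  set e : ℝ := ε / (2 * (C * κ + 1)) with he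
  have he0 : 0 < e := by positivity
  -- This function of `((β, s), x)` vanishes at `((x, x), x)` by the choice of `F`. Uniform
  -- continuity makes it at most `e` when `β` and `s` are close to `x`.
  have hq : ContinuousOn (fun p : (ℝ × ℝ) × ℝ => φ p.1.1 p.1.2 - G p.1.1 p.1.2 *ᵥ F p.2)
      ((Icc a b ×ˢ Icc a b) ×ˢ Icc a b) := by
    have h1 : ContinuousOn (fun p : (ℝ × ℝ) × ℝ => F p.2) ((Icc a b ×ˢ Icc a b) ×ˢ Icc a b) :=
      hF.comp continuousOn_snd fun p hp => hp.2
    have h2 : Continuous fun q : Matrix (Fin n) (Fin n) ℂ × (Fin n → ℂ) => q.1 *ᵥ q.2 :=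
      continuous_mulVec_comp continuous_fst continuous_snd
    exact (hφc.comp continuous_fst).continuousOn.sub
      (h2.comp_continuousOn ((hGc.comp continuous_fst).continuousOn.prodMk h1))
  have huc := ((isCompact_Icc.prod isCompact_Icc).prod isCompact_Icc : IsCompact
    ((Icc a b ×ˢ Icc a b) ×ˢ Icc a b)).uniformContinuousOn_of_continuous hq
  obtain ⟨δ, hδ, hδq⟩ := Metric.uniformContinuousOn_iff.1 huc e he0
  have hsmall : ∀ x ∈ Icc a b, ∀ β ∈ Icc a b, ∀ s ∈ Icc a b, |β - x| < δ → |s - x| < δ →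
      ‖φ β s - G β s *ᵥ F x‖ ≤ e := fun x hx β hβ s hs h1 h2 => by
    have h3 := hδq ((β, s), x) ⟨⟨hβ, hs⟩, hx⟩ ((x, x), x) ⟨⟨hx, hx⟩, hx⟩ (by
      simp only [Prod.dist_eq, dist_self, Real.dist_eq]
      exact max_lt (max_lt h1 h2) hδ)
    simp only at h3
    rw [hFd x hx, sub_self, dist_zero_right] at h3
    exact h3.le
  refine ⟨δ / 2, half_pos hδ, fun N x τ hx0 hxN hxτ => ?_⟩
  -- The dual partition `t, τ 0, …, τ (N - 1), b`; the points `x i` are its tags, with `p i ≤ x i ≤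
  -- p (i + 1)`.
  set p : ℕ → ℝ := fun i => Nat.casesOn i t fun j => if j < N then τ j else b with hp
  have hp0 : p 0 = t := rfl
  have hps : ∀ i, i < N → p (i + 1) = τ i := fun i hi => by simp [hp, hi]
  have hpN : p (N + 1) = b := by simp [hp]
  have hpx : ∀ i ≤ N, p i ≤ x i ∧ x i - p i < δ / 2 := by
    intro i hi
    cases i with
    | zero => rw [hp0, hx0]; exact ⟨le_rfl, by simpa using half_pos hδ⟩
    | succ j =>
      rw [hps j hi]
      have := hxτ j hi
      exact ⟨this.2.1, by linarith⟩
  have hxp : ∀ i ≤ N, x i ≤ p (i + 1) ∧ p (i + 1) - x i < δ / 2 := by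
    intro i hi
    rcases hi.lt_or_eq with h | rfl
    · rw [hps i h]
      have := hxτ i h
      exact ⟨this.1, by linarith⟩
    · rw [hpN, hxN]; exact ⟨le_rfl, by simpa using half_pos hδ⟩
  have hpmono : ∀ i ≤ N, p i ≤ p (i + 1) := fun i hi => (hpx i hi).1.trans (hxp i hi).1
  have hpt : ∀ i ≤ N + 1, t ≤ p i := by
    intro i
    induction i with
    | zero => intro _; exact hp0.ge
    | succ i ih => intro hi; exact (ih (by omega)).trans (hpmono i (by omega))
  have hpb : ∀ j ≤ N + 1, p (N + 1 - j) ≤ b := by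
    intro j
    induction j with
    | zero => intro _; exact hpN.le
    | succ j ih =>
      intro hj
      refine le_trans ?_ (ih (by omega))
      have := hpmono (N + 1 - (j + 1)) (by omega)
      rwa [show N + 1 - (j + 1) + 1 = N + 1 - j by omega] at this
  have hpm : ∀ i ≤ N + 1, p i ∈ Icc t b := fun i hi => ⟨hpt i hi, by
    have := hpb (N + 1 - i) (by omega)
    rwa [show N + 1 - (N + 1 - i) = i by omega] at this⟩
  have htb : Icc t b ⊆ Icc a b := Icc_subset_Icc_left ht.1
  have hxm : ∀ i ≤ N, x i ∈ Icc a b := fun i hi => htb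
    ⟨(hpm i (by omega)).1.trans (hpx i hi).1, (hxp i hi).1.trans (hpm (i + 1) (by omega)).2⟩
  -- By `increment_add_convOp`, `w i` solves the equation truncated at `p i` with a right-hand side
  -- of size `e` times the kernel mass over `[p i, p (i + 1)]`. These masses add up to at most `κ`.
  let w : ℕ → ℝ → Fin n → ℂ := fun i s =>
    (φ (p (i + 1)) s - G (p (i + 1)) s *ᵥ F (x i)) - (φ (p i) s - G (p i) s *ᵥ F (x i))
  have hsum := hC (Finset.range (N + 1)) p
    (fun i hi => htb (hpm i (Finset.mem_range.1 hi).le)) w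
    (fun i _ => (continuous_sub_mulVec hGc hφc _ _).sub (continuous_sub_mulVec hGc hφc _ _))
    (e * κ) (fun y hy => by
      have hterm : ∀ i ∈ Finset.range (N + 1), ‖w i y + convOp H a (p i) (w i) y‖ ≤
          e * ∫ s in (p i)..(p (i + 1)), opBound (H (y - s)) := fun i hi => by
        have hi' : i ≤ N := Nat.lt_succ_iff.1 (Finset.mem_range.1 hi)
        have hm1 := htb (hpm i (by omega))
        have hm2 := htb (hpm (i + 1) (by omega))
        rw [hH.increment_add_convOp hGc hφc hG hφ (F (x i)) hm1 hm2 hy, norm_neg]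
        refine hH.norm_integral_mulVec_le_mul (continuous_sub_mulVec hGc hφc _ _) y
          (hpmono i hi') fun s hs => ?_
        have h1 := hpx i hi'
        have h2 := hxp i hi'
        refine hsmall (x i) (hxm i hi') _ hm2 s ⟨hm1.1.trans hs.1, hs.2.trans hm2.2⟩ ?_ ?_
        · rw [abs_of_nonneg (by linarith)]; linarith
        · rw [abs_lt]; constructor <;> linarith [hs.1, hs.2]
      calc ∑ i ∈ Finset.range (N + 1) with y ≤ p i, ‖w i y + convOp H a (p i) (w i) y‖
          ≤ ∑ i ∈ Finset.range (N + 1), ‖w i y + convOp H a (p i) (w i) y‖ :=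
            Finset.sum_le_sum_of_subset_of_nonneg (Finset.filter_subset _ _)
              fun i _ _ => norm_nonneg _
        _ ≤ ∑ i ∈ Finset.range (N + 1), e * ∫ s in (p i)..(p (i + 1)), opBound (H (y - s)) :=
            Finset.sum_le_sum hterm
        _ = e * ∫ s in t..b, opBound (H (y - s)) := by
            rw [← Finset.mul_sum, intervalIntegral.sum_integral_adjacent_intervals
              fun i _ => hH.intervalIntegrable_opBound y _ _, hp0, hpN]
        _ ≤ e * κ := mul_le_mul_of_nonneg_left (hH.integral_opBound_le y ht.2) he0.le)
    t ht
  rw [Finset.filter_true_of_mem fun i hi => (hpm i (Finset.mem_range.1 hi).le).1] at hsum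
  -- The `φ` increments telescope and the `G` increments are summed by parts; the boundary term `G t
  -- t *ᵥ F t` equals `φ t t` and cancels.
  have hid : (∑ i ∈ Finset.range N, A (τ i) *ᵥ (F (x (i + 1)) - F (x i))) -
      (G b t *ᵥ F b - φ b t) = ∑ i ∈ Finset.range (N + 1), w i t := by
    have h1 := sum_sub_mulVec_by_parts (fun i => G (p i) t) (fun i => F (x i)) N
    have h2 : ∑ i ∈ Finset.range N, A (τ i) *ᵥ (F (x (i + 1)) - F (x i)) =
        ∑ i ∈ Finset.range N, G (p (i + 1)) t *ᵥ (F (x (i + 1)) - F (x i)) :=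
      Finset.sum_congr rfl fun i hi => by
        have hi' := Finset.mem_range.1 hi
        rw [← hps i hi', hA _ (hpm (i + 1) (by omega))]
    have h3 : ∑ i ∈ Finset.range (N + 1), w i t = (φ b t - φ t t) -
        ∑ i ∈ Finset.range (N + 1), (G (p (i + 1)) t - G (p i) t) *ᵥ F (x i) := by
      have h4 := Finset.sum_range_sub (fun i => φ (p i) t) (N + 1)
      simp only [hp0, hpN] at h4
      rw [← h4, ← Finset.sum_sub_distrib]
      refine Finset.sum_congr rfl fun i _ => ?_
      simp only [w, Matrix.sub_mulVec]
      abel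
    rw [hp0, hpN, hx0, hxN, ← hFd t ht] at h1
    rw [h2, h3, eq_sub_iff_add_eq'.2 h1]
    abel
  rw [hid]
  refine ((norm_sum_le _ _).trans hsum).trans_lt ?_
  have h5 : C * (e * κ) = ε * (C * κ) / (2 * (C * κ + 1)) := by rw [he]; ring
  rw [h5, div_lt_iff₀ (by positivity)]
  nlinarith [mul_nonneg hC0 hκ0]

end Increment

end EvenKernel

/-! ### Absolute continuity of the quotient -/

/-- Absolute continuity is uniform with respect to translations of a family of intervals. -/
lemma exists_sum_dist_translate_lt {X : Type*} [PseudoMetricSpace X] {h : ℝ → X} {c d : ℝ}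
    (hcd : c ≤ d) (hh : AbsolutelyContinuousOnInterval h c d) {ε : ℝ} (hε : 0 < ε) :
    ∃ δ > 0, ∀ (N : ℕ) (α β : ℕ → ℝ) (σ : ℝ) (p : ℕ → Prop) [DecidablePred p],
      (∀ i ∈ Finset.range N, α i ≤ β i) →
      Set.PairwiseDisjoint (Finset.range N : Set ℕ) (fun i => Ioc (α i) (β i)) →
      ∑ i ∈ Finset.range N, (β i - α i) < δ →
      (∀ i ∈ Finset.range N, p i → α i + σ ∈ Icc c d ∧ β i + σ ∈ Icc c d) →
      ∑ i ∈ Finset.range N with p i, dist (h (α i + σ)) (h (β i + σ)) < ε := by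
  obtain ⟨δ, hδ, hE⟩ := (absolutelyContinuousOnInterval_iff h c d).1 hh ε hε
  refine ⟨δ, hδ, fun N α β σ p _ hαβ hdisj hlen hmem => ?_⟩
  -- Intervals excluded by `p` are replaced by the degenerate pair `(c, c)`, which contributes
  -- neither length nor increment. Translation changes no lengths, so `δ` is independent of `σ`.
  have h1 := hE (N, fun i => if p i then (α i + σ, β i + σ) else (c, c)) ⟨?_, ?_⟩ ?_
  · refine lt_of_eq_of_lt ?_ h1
    rw [Finset.sum_filter]
    refine Finset.sum_congr rfl fun i _ => ?_
    by_cases hpi : p i <;> simp [hpi]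
  · intro i hi
    rw [uIcc_of_le hcd]
    by_cases hpi : p i
    · simpa [hpi] using hmem i hi hpi
    · simp [hpi, hcd]
  · intro i hi j hj hij
    have hd := hdisj hi hj hij
    have hle := hαβ i hi
    have hle' := hαβ j hj
    simp only [Function.onFun]
    by_cases hpi : p i
    · by_cases hpj : p j
      · simp only [hpi, hpj, if_true]
        rw [uIoc_of_le (by linarith), uIoc_of_le (by linarith), Set.disjoint_left]
        intro x hx hx'
        exact Set.disjoint_left.1 hd
          (show x - σ ∈ Ioc (α i) (β i) from ⟨by linarith [hx.1], by linarith [hx.2]⟩)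
          ⟨by linarith [hx'.1], by linarith [hx'.2]⟩
      · simp [hpj]
    · simp [hpi]
  · refine lt_of_le_of_lt (Finset.sum_le_sum fun i hi => ?_) hlen
    have hle := hαβ i hi
    by_cases hpi : p i
    · simp only [hpi, if_true, Real.dist_eq]
      rw [abs_sub_comm, abs_of_nonneg (by linarith)]
      linarith
    · simp only [hpi, if_false, dist_self]
      linarith

/-- The increments of an absolutely continuous function may be tested on ordered intervals. -/
lemma absolutelyContinuousOnInterval_of_ordered {X : Type*} [PseudoMetricSpace X] {h : ℝ → X}
    {c d : ℝ} (hcd : c ≤ d)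
    (hh : ∀ ε > 0, ∃ δ > 0, ∀ (N : ℕ) (α β : ℕ → ℝ),
      (∀ i ∈ Finset.range N, α i ∈ Icc c d ∧ β i ∈ Icc c d ∧ α i ≤ β i) →
      Set.PairwiseDisjoint (Finset.range N : Set ℕ) (fun i => Ioc (α i) (β i)) →
      ∑ i ∈ Finset.range N, (β i - α i) < δ →
      ∑ i ∈ Finset.range N, dist (h (α i)) (h (β i)) < ε) :
    AbsolutelyContinuousOnInterval h c d := by
  rw [absolutelyContinuousOnInterval_iff]
  intro ε hε
  obtain ⟨δ, hδ, H⟩ := hh ε hε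
  refine ⟨δ, hδ, ?_⟩
  rintro ⟨N, I⟩ ⟨hI, hdisj⟩ hlen
  have h1 := H N (fun i => min (I i).1 (I i).2) (fun i => max (I i).1 (I i).2)
    (fun i hi => by
      have := hI i hi
      rw [uIcc_of_le hcd] at this
      exact ⟨⟨le_min this.1.1 this.2.1, (min_le_left _ _).trans this.1.2⟩,
        ⟨this.1.1.trans (le_max_left _ _), max_le this.1.2 this.2.2⟩, min_le_max⟩)
    hdisj
    (lt_of_eq_of_lt (Finset.sum_congr rfl fun i _ => by
      rw [max_sub_min_eq_abs, abs_sub_comm, Real.dist_eq]) hlen)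
  refine lt_of_eq_of_lt (Finset.sum_congr rfl fun i _ => ?_) h1
  rcases le_total (I i).1 (I i).2 with hle | hle
  · simp [hle]
  · simp only [min_eq_right hle, max_eq_left hle]
    exact dist_comm _ _

namespace EvenKernel

variable {H : ℝ → Matrix (Fin n) (Fin n) ℂ} (hH : EvenKernel H) {a b : ℝ}
include hH

/-- Written as an increment of the primitive translated by `-t`, the kernel mass is controlled by
absolute continuity uniformly in `t`. -/
lemma integral_opBound_eq_dist {α β : ℝ} (hαβ : α ≤ β) (t : ℝ) :
    ∫ x in α..β, opBound (H (t - x)) = dist (∫ x in (0 : ℝ)..(α + -t), opBound (H x))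
      (∫ x in (0 : ℝ)..(β + -t), opBound (H x)) := by
  have h1 : ∫ s in α..β, opBound (H (t - s)) = ∫ s in α..β, opBound (H (s - t)) :=
    intervalIntegral.integral_congr fun s _ => by simp only [hH.sub_comm t s]
  have h0 : 0 ≤ ∫ s in α..β, opBound (H (t - s)) :=
    intervalIntegral.integral_nonneg hαβ fun _ _ => opBound_nonneg _
  have h2 : ∫ s in α..β, opBound (H (t - s)) = (∫ x in (0 : ℝ)..(β + -t), opBound (H x)) -
      ∫ x in (0 : ℝ)..(α + -t), opBound (H x) := by
    rw [h1, intervalIntegral.integral_comp_sub_right (fun x => opBound (H x)) t,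
      intervalIntegral.integral_interval_sub_left
      hH.integrable_opBound.intervalIntegrable hH.integrable_opBound.intervalIntegrable]
    simp only [sub_eq_add_neg]
  rw [dist_comm, Real.dist_eq, ← h2, abs_of_nonneg h0]

section Increment

variable {G : ℝ → ℝ → Matrix (Fin n) (Fin n) ℂ} {f : ℝ → Fin n → ℂ} {φ : ℝ → ℝ → Fin n → ℂ}
  (hGc : Continuous fun p : ℝ × ℝ => G p.1 p.2) (hφc : Continuous fun p : ℝ × ℝ => φ p.1 p.2)
  (hG : ∀ c : Fin n → ℂ, ∀ ξ ∈ Icc a b, ∀ t ∈ Icc a b,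
    G ξ t *ᵥ c + convOp H a ξ (fun s => G ξ s *ᵥ c) t = c)
  (hφ : ∀ ξ ∈ Icc a b, ∀ t ∈ Icc a b, φ ξ t + convOp H a ξ (φ ξ) t = f t)
include hGc hφc hG hφ

/-- The quotient of the diagonal values is absolutely continuous if the right-hand side is. -/
theorem absolutelyContinuousOnInterval_quotient (hab : a ≤ b) (hinj : InjectiveTruncations H a b)
    {F : ℝ → Fin n → ℂ} (hF : ContinuousOn F (Icc a b))
    (hFd : ∀ ξ ∈ Icc a b, φ ξ ξ = G ξ ξ *ᵥ F ξ) (hdet : ∀ ξ ∈ Icc a b, (G ξ ξ).det ≠ 0)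
    (hf : AbsolutelyContinuousOnInterval f a b) :
    AbsolutelyContinuousOnInterval F a b := by
  obtain ⟨C, hC0, hC⟩ := hH.exists_sum_diagonal_sub_le hab hinj
  have hGd : Continuous fun ξ => G ξ ξ := hGc.comp (continuous_id.prodMk continuous_id)
  obtain ⟨D, hD⟩ := isCompact_Icc.exists_bound_of_continuousOn
    (continuous_opBound.comp_continuousOn (continuousOn_inv hGd.continuousOn hdet))
  have hq : ContinuousOn (fun p : (ℝ × ℝ) × ℝ => φ p.1.1 p.1.2 - G p.1.1 p.1.2 *ᵥ F p.2)
      ((Icc a b ×ˢ Icc a b) ×ˢ Icc a b) := by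
    have h1 : ContinuousOn (fun p : (ℝ × ℝ) × ℝ => F p.2) ((Icc a b ×ˢ Icc a b) ×ˢ Icc a b) :=
      hF.comp continuousOn_snd fun p hp => hp.2
    have h2 : Continuous fun q : Matrix (Fin n) (Fin n) ℂ × (Fin n → ℂ) => q.1 *ᵥ q.2 :=
      continuous_mulVec_comp continuous_fst continuous_snd
    exact (hφc.comp continuous_fst).continuousOn.sub
      (h2.comp_continuousOn ((hGc.comp continuous_fst).continuousOn.prodMk h1))
  obtain ⟨m, hm⟩ := ((isCompact_Icc.prod isCompact_Icc).prod isCompact_Icc : IsCompact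
    ((Icc a b ×ˢ Icc a b) ×ˢ Icc a b)).exists_bound_of_continuousOn hq
  have hma : a ∈ Icc a b := ⟨le_rfl, hab⟩
  have hm0 : 0 ≤ m := (norm_nonneg _).trans (hm ((a, a), a) ⟨⟨hma, hma⟩, hma⟩)
  have hD0 : 0 ≤ D := (norm_nonneg _).trans (hD a hma)
  have hK : AbsolutelyContinuousOnInterval (fun x : ℝ => ∫ y in (0 : ℝ)..x, opBound (H y))
      (a - b) (b - a) :=
    (hH.integrable_opBound.intervalIntegrable
      ).absolutelyContinuousOnInterval_intervalIntegral
      (by rw [uIcc_of_le (by linarith)]; constructor <;> linarith)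
  refine absolutelyContinuousOnInterval_of_ordered hab fun ε hε => ?_
  set e : ℝ := ε / (2 * (D * C * (1 + m) + 1)) with he
  have he0 : 0 < e := by positivity
  obtain ⟨δ₁, hδ₁, hf₁⟩ := exists_sum_dist_translate_lt hab hf he0
  obtain ⟨δ₂, hδ₂, hK₂⟩ := exists_sum_dist_translate_lt (by linarith) hK he0
  refine ⟨min δ₁ δ₂, lt_min hδ₁ hδ₂, fun N α β hαβ hdisj hlen => ?_⟩
  have hle : ∀ i ∈ Finset.range N, α i ≤ β i := fun i hi => (hαβ i hi).2.2
  -- With `c = F (α i)` subtracted, the diagonal value at `α i` is zero and the one at `β i` is `G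
  -- (β i) (β i) *ᵥ (F (β i) - F (α i))`. The bound on diagonal increments thus controls the
  -- increments of `F`, once the inverse of `G ξ ξ` is bounded by `D`.
  have hsum := hC (Finset.range N) α β (fun i hi => (hαβ i hi).1) hle
    (fun i t => f t - F (α i)) (fun i s => φ (β i) s - G (β i) s *ᵥ F (α i))
    (fun i s => φ (α i) s - G (α i) s *ᵥ F (α i))
    (fun i _ => continuous_sub_mulVec hGc hφc _ _) (fun i _ => continuous_sub_mulVec hGc hφc _ _)
    (fun i hi t ht => hH.sub_mulVec_add_convOp hGc hφc hG hφ _ (hαβ i hi).2.1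
      ⟨ht.1, ht.2.trans (hαβ i hi).2.1.2⟩)
    (fun i hi t ht => hH.sub_mulVec_add_convOp hGc hφc hG hφ _ (hαβ i hi).1
      ⟨ht.1, ht.2.trans (hαβ i hi).1.2⟩)
    (fun _ => m) (fun i hi x hx => by
      have h1 := hαβ i hi
      exact hm ((β i, x), α i) ⟨⟨h1.2.1, hx.1, by linarith [hx.2, h1.1.1, h1.2.1.2]⟩, h1.1⟩)
    (e + m * e) (fun t ht => by
      rw [Finset.sum_add_distrib, ← Finset.mul_sum]
      refine add_le_add ?_ (mul_le_mul_of_nonneg_left ?_ hm0)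
      · have h1 := hf₁ N α β (a - t) (fun i => t ≤ α i) hle hdisj
          (hlen.trans_le (min_le_left _ _)) (fun i hi hti => by
            have h2 := hαβ i hi
            constructor <;> constructor <;> linarith [ht.1, h2.1.1, h2.1.2, h2.2.1.1, h2.2.1.2, h2.2.2])
        refine le_trans (le_of_eq (Finset.sum_congr rfl fun i _ => ?_)) h1.le
        rw [dist_comm, dist_eq_norm, sub_sub_sub_cancel_right, add_sub_assoc, add_sub_assoc]
      · have h1 := hK₂ N α β (-t) (fun i => t ≤ α i) hle hdisj
          (hlen.trans_le (min_le_right _ _)) (fun i hi hti => by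
            have h2 := hαβ i hi
            constructor <;> constructor <;> linarith [ht.1, h2.1.1, h2.1.2, h2.2.1.1, h2.2.1.2, h2.2.2])
        refine le_trans (le_of_eq (Finset.sum_congr rfl fun i hi => ?_)) h1.le
        exact hH.integral_opBound_eq_dist (hle i (Finset.mem_filter.1 hi).1) t)
  calc ∑ i ∈ Finset.range N, dist (F (α i)) (F (β i))
      ≤ ∑ i ∈ Finset.range N, D * ‖(φ (β i) (β i) - G (β i) (β i) *ᵥ F (α i)) -
          (φ (α i) (α i) - G (α i) (α i) *ᵥ F (α i))‖ := by
        refine Finset.sum_le_sum fun i hi => ?_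
        have h1 := hαβ i hi
        rw [hFd _ h1.2.1, hFd _ h1.1, sub_self, sub_zero, ← Matrix.mulVec_sub, dist_comm,
          dist_eq_norm]
        have h2 : F (β i) - F (α i) =
            (G (β i) (β i))⁻¹ *ᵥ (G (β i) (β i) *ᵥ (F (β i) - F (α i))) := by
          rw [Matrix.mulVec_mulVec, Matrix.nonsing_inv_mul _ (isUnit_iff_ne_zero.2
            (hdet _ h1.2.1)), Matrix.one_mulVec]
        conv_lhs => rw [h2]
        refine (norm_mulVec_le _ _).trans (mul_le_mul_of_nonneg_right ?_ (norm_nonneg _))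
        exact (le_abs_self _).trans (hD _ h1.2.1)
    _ ≤ D * (C * (e + m * e)) := by
        rw [← Finset.mul_sum]
        exact mul_le_mul_of_nonneg_left hsum hD0
    _ < ε := by
        have h5 : D * (C * (e + m * e)) =
            ε * (D * C * (1 + m)) / (2 * (D * C * (1 + m) + 1)) := by rw [he]; ring
        have h6 : 0 ≤ D * C * (1 + m) := by positivity
        rw [h5, div_lt_iff₀ (by positivity)]
        nlinarith

end Increment

end EvenKernel

/-! ### From the Stieltjes integral to the Lebesgue integral -/

/-- The fundamental theorem of calculus for absolutely continuous vector functions. -/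
theorem absolutelyContinuous_integral_deriv {F : ℝ → Fin n → ℂ} {a b : ℝ}
    (hF : AbsolutelyContinuousOnInterval F a b) :
    (∀ᵐ x, x ∈ uIcc a b → DifferentiableAt ℝ F x) ∧ IntervalIntegrable (deriv F) volume a b ∧
      ∫ x in a..b, deriv F x = F b - F a := by
  have hae : ∀ᵐ x, x ∈ uIcc a b → DifferentiableAt ℝ F x :=
    hF.boundedVariationOn.ae_differentiableAt_of_mem_uIcc
  have hcomp : ∀ L : (Fin n → ℂ) →L[ℝ] ℝ, AbsolutelyContinuousOnInterval (fun x => L (F x)) a b ∧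
      ∀ᵐ x, x ∈ uIoc a b → deriv (fun x => L (F x)) x = L (deriv F x) := by
    refine fun L => ⟨?_, ?_⟩
    · refine squeeze_zero (fun E => Finset.sum_nonneg fun _ _ => dist_nonneg)
        (fun E => ?_) (by simpa using! Filter.Tendsto.const_mul ‖L‖ hF)
      rw [Finset.mul_sum]
      refine Finset.sum_le_sum fun i _ => ?_
      rw [dist_eq_norm, dist_eq_norm, ← map_sub]
      exact L.le_opNorm _
    · filter_upwards [hae] with x hx hxm
      exact (L.hasFDerivAt.comp_hasDerivAt x (hx (uIoc_subset_uIcc hxm)).hasDerivAt).deriv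
  have hLint : ∀ L : (Fin n → ℂ) →L[ℝ] ℝ, IntervalIntegrable (fun x => L (deriv F x)) volume a b ∧
      ∫ x in a..b, L (deriv F x) = L (F b) - L (F a) := fun L => by
    obtain ⟨h1, h2⟩ := hcomp L
    refine ⟨h1.intervalIntegrable_deriv.congr_ae ((ae_restrict_iff' measurableSet_uIoc).2 h2), ?_⟩
    rw [← h1.integral_deriv_eq_sub]
    exact intervalIntegral.integral_congr_ae (h2.mono fun x hx hxm => (hx hxm).symm)
  -- The real theorem is applied to the real and imaginary parts of the coordinates, which determine
  -- the vector.
  let re : Fin n → (Fin n → ℂ) →L[ℝ] ℝ := fun i =>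
    Complex.reCLM.comp (ContinuousLinearMap.proj (R := ℝ) (φ := fun _ : Fin n => ℂ) i)
  let im : Fin n → (Fin n → ℂ) →L[ℝ] ℝ := fun i =>
    Complex.imCLM.comp (ContinuousLinearMap.proj (R := ℝ) (φ := fun _ : Fin n => ℂ) i)
  have hcoord : ∀ i, IntervalIntegrable (fun x => deriv F x i) volume a b := fun i => by
    have h1 : IntervalIntegrable (fun x => ((re i (deriv F x) : ℝ) : ℂ) +
        ((im i (deriv F x) : ℝ) : ℂ) * Complex.I) volume a b := by
      refine IntervalIntegrable.add ?_ (IntervalIntegrable.mul_const ?_ _)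
      · exact ⟨(hLint (re i)).1.1.ofReal, (hLint (re i)).1.2.ofReal⟩
      · exact ⟨(hLint (im i)).1.1.ofReal, (hLint (im i)).1.2.ofReal⟩
    refine h1.congr fun x _ => ?_
    simp [re, im, Complex.re_add_im]
  have hint : IntervalIntegrable (deriv F) volume a b := by
    rw [intervalIntegrable_iff]
    exact Integrable.of_eval fun i => intervalIntegrable_iff.1 (hcoord i)
  refine ⟨hae, hint, ?_⟩
  ext i
  refine Complex.ext ?_ ?_
  · change re i (∫ x in a..b, deriv F x) = re i (F b - F a)
    rw [← (re i).intervalIntegral_comp_comm hint, (hLint (re i)).2, map_sub]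
  · change im i (∫ x in a..b, deriv F x) = im i (F b - F a)
    rw [← (im i).intervalIntegral_comp_comm hint, (hLint (im i)).2, map_sub]

lemma intervalIntegrable_mulVec_of_continuousOn {A : ℝ → Matrix (Fin n) (Fin n) ℂ}
    {F : ℝ → Fin n → ℂ} {c d : ℝ} (hA : ContinuousOn A (uIcc c d))
    (hF : IntervalIntegrable F volume c d) :
    IntervalIntegrable (fun x => A x *ᵥ F x) volume c d := by
  rw [intervalIntegrable_iff]
  refine Integrable.of_eval fun i => ?_
  simp only [Matrix.mulVec, dotProduct]
  refine integrable_finsetSum _ fun j _ => ?_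
  have h1 : IntervalIntegrable (fun s => F s j) volume c d := by
    rw [intervalIntegrable_iff] at hF ⊢
    exact Integrable.eval hF j
  have h2 : ContinuousOn (fun s => A s i j) (uIcc c d) :=
    (continuous_id.matrix_elem i j).comp_continuousOn hA
  exact intervalIntegrable_iff.1 (h1.continuousOn_mul h2)

/-- The Stieltjes integral with respect to the primitive of an integrable function. -/
theorem hasStieltjesIntegral_of_integral_eq_sub {A : ℝ → Matrix (Fin n) (Fin n) ℂ}
    {F F' : ℝ → Fin n → ℂ} {c d : ℝ} (hcd : c ≤ d) (hA : ContinuousOn A (Icc c d))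
    (hF' : IntervalIntegrable F' volume c d)
    (hF : ∀ x ∈ Icc c d, ∀ y ∈ Icc c d, ∫ s in x..y, F' s = F y - F x) :
    HasStieltjesIntegral A F c d (∫ ξ in c..d, A ξ *ᵥ F' ξ) := by
  intro ε hε
  set κ : ℝ := ∫ ξ in c..d, ‖F' ξ‖ with hκ
  have hκ0 : 0 ≤ κ := intervalIntegral.integral_nonneg hcd fun _ _ => norm_nonneg _
  set e : ℝ := ε / (2 * (κ + 1)) with he
  have he0 : 0 < e := by positivity
  have hq : ContinuousOn (fun p : ℝ × ℝ => opBound (A p.1 - A p.2)) (Icc c d ×ˢ Icc c d) :=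
    continuous_opBound.comp_continuousOn ((hA.comp continuousOn_fst fun p hp => hp.1).sub
      (hA.comp continuousOn_snd fun p hp => hp.2))
  obtain ⟨δ, hδ, hδq⟩ := Metric.uniformContinuousOn_iff.1
    ((isCompact_Icc.prod isCompact_Icc).uniformContinuousOn_of_continuous hq) e he0
  have hop0 : opBound (0 : Matrix (Fin n) (Fin n) ℂ) = 0 := by
    unfold opBound
    rw [show (fun i j => (0 : Matrix (Fin n) (Fin n) ℂ) i j : Fin n → Fin n → ℂ) = 0 from rfl,
      norm_zero, mul_zero]
  have hsmall : ∀ x ∈ Icc c d, ∀ y ∈ Icc c d, |x - y| < δ → opBound (A x - A y) ≤ e :=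
    fun x hx y hy hxy => by
      have h1 := hδq (x, y) ⟨hx, hy⟩ (y, y) ⟨hy, hy⟩ (by
        rw [Prod.dist_eq, dist_self, Real.dist_eq]; exact max_lt hxy hδ)
      simp only [sub_self, hop0, dist_zero_right] at h1
      exact (le_abs_self _).trans h1.le
  refine ⟨δ, hδ, fun N x τ hx0 hxN hxτ => ?_⟩
  have hstep : ∀ i < N, x i ≤ x (i + 1) := fun i hi => (hxτ i hi).1.trans (hxτ i hi).2.1
  have hlow : ∀ i ≤ N, c ≤ x i := by
    intro i
    induction i with
    | zero => intro _; exact hx0.ge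
    | succ i ih => intro hi; exact (ih (by omega)).trans (hstep i (by omega))
  have hhigh : ∀ j ≤ N, x (N - j) ≤ d := by
    intro j
    induction j with
    | zero => intro _; exact hxN.le
    | succ j ih =>
      intro hj
      refine le_trans ?_ (ih (by omega))
      have := hstep (N - (j + 1)) (by omega)
      rwa [show N - (j + 1) + 1 = N - j by omega] at this
  have hmem : ∀ i ≤ N, x i ∈ Icc c d := fun i hi => ⟨hlow i hi, by
    have := hhigh (N - i) (by omega)
    rwa [show N - (N - i) = i by omega] at this⟩
  have hsub : ∀ i < N, uIcc (x i) (x (i + 1)) ⊆ Icc c d := fun i hi =>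
    uIcc_subset_Icc (hmem i hi.le) (hmem (i + 1) hi)
  have hFi : ∀ i < N, IntervalIntegrable F' volume (x i) (x (i + 1)) := fun i hi =>
    hF'.mono_set (by rw [uIcc_of_le hcd]; exact hsub i hi)
  have hAFi : ∀ i < N, IntervalIntegrable (fun ξ => A ξ *ᵥ F' ξ) volume (x i) (x (i + 1)) :=
    fun i hi => intervalIntegrable_mulVec_of_continuousOn (hA.mono (hsub i hi)) (hFi i hi)
  have hsplit := intervalIntegral.sum_integral_adjacent_intervals hAFi
  have hsplitn := intervalIntegral.sum_integral_adjacent_intervals fun i hi => (hFi i hi).norm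
  rw [hx0, hxN] at hsplit hsplitn
  rw [← hsplit, ← Finset.sum_sub_distrib]
  have hterm : ∀ i ∈ Finset.range N, ‖A (τ i) *ᵥ (F (x (i + 1)) - F (x i)) -
      ∫ ξ in (x i)..(x (i + 1)), A ξ *ᵥ F' ξ‖ ≤ e * ∫ ξ in (x i)..(x (i + 1)), ‖F' ξ‖ := by
    intro i hi
    have hi' := Finset.mem_range.1 hi
    have hconst : IntervalIntegrable (fun ξ => A (τ i) *ᵥ F' ξ) volume (x i) (x (i + 1)) :=
      intervalIntegrable_mulVec_of_continuousOn continuousOn_const (hFi i hi')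
    -- With the increment of `F` written as an integral of `F'`, the error on one interval is the
    -- integral of `(A (τ i) - A ξ) *ᵥ F' ξ`, small by uniform continuity of `A`.
    have h1 : A (τ i) *ᵥ (F (x (i + 1)) - F (x i)) = ∫ ξ in (x i)..(x (i + 1)), A (τ i) *ᵥ F' ξ := by
      rw [← hF _ (hmem i hi'.le) _ (hmem (i + 1) hi')]
      exact ((Matrix.mulVecLin (A (τ i))).toContinuousLinearMap.intervalIntegral_comp_comm
        (hFi i hi')).symm
    rw [h1, ← intervalIntegral.integral_sub hconst (hAFi i hi'),
      ← intervalIntegral.integral_const_mul]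
    refine intervalIntegral.norm_integral_le_of_norm_le (hstep i hi')
      (Eventually.of_forall fun ξ hξ => ?_) ((hFi i hi').norm.const_mul e)
    rw [← Matrix.sub_mulVec]
    refine (norm_mulVec_le _ _).trans (mul_le_mul_of_nonneg_right ?_ (norm_nonneg _))
    have h2 := hxτ i hi'
    have h3 := hmem i hi'.le
    have h4 := hmem (i + 1) hi'
    refine hsmall _ ⟨h3.1.trans h2.1, h2.2.1.trans h4.2⟩ _
      ⟨h3.1.trans hξ.1.le, hξ.2.trans h4.2⟩ ?_
    rw [abs_lt]; constructor <;> linarith [hξ.1, hξ.2]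
  refine ((norm_sum_le _ _).trans (Finset.sum_le_sum hterm)).trans_lt ?_
  rw [← Finset.mul_sum, hsplitn, he, div_mul_eq_mul_div, div_lt_iff₀ (by positivity)]
  nlinarith

lemma HasStieltjesIntegral.unique {A : ℝ → Matrix (Fin n) (Fin n) ℂ} {F : ℝ → Fin n → ℂ}
    {c d : ℝ} (hcd : c ≤ d) {J J' : Fin n → ℂ} (hJ : HasStieltjesIntegral A F c d J)
    (hJ' : HasStieltjesIntegral A F c d J') : J = J' := by
  refine eq_of_forall_dist_le fun ε hε => ?_
  obtain ⟨δ, hδ, h⟩ := hJ (ε / 2) (half_pos hε)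
  obtain ⟨δ', hδ', h'⟩ := hJ' (ε / 2) (half_pos hε)
  have hρ : 0 < min δ δ' := lt_min hδ hδ'
  obtain ⟨N, hN⟩ := exists_nat_gt ((d - c) / min δ δ')
  have hdc : 0 ≤ d - c := sub_nonneg.2 hcd
  have hN0 : (0 : ℝ) < N := lt_of_le_of_lt (by positivity) hN
  have hmesh : (d - c) / N < min δ δ' := by
    rw [div_lt_iff₀ hρ] at hN
    rw [div_lt_iff₀ hN0]; linarith
  set x : ℕ → ℝ := fun i => c + i * ((d - c) / N) with hx
  have hx0 : x 0 = c := by simp [hx]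
  have hxN : x N = d := by simp only [hx]; field_simp; ring
  have hxs : ∀ i, x (i + 1) - x i = (d - c) / N := fun i => by simp only [hx]; push_cast; ring
  have hpos : 0 ≤ (d - c) / N := by positivity
  have h1 := h N x x hx0 hxN fun i _ => ⟨le_rfl, by linarith [hxs i],
    by rw [hxs]; exact hmesh.trans_le (min_le_left _ _)⟩
  have h2 := h' N x x hx0 hxN fun i _ => ⟨le_rfl, by linarith [hxs i],
    by rw [hxs]; exact hmesh.trans_le (min_le_right _ _)⟩
  rw [← dist_eq_norm] at h1 h2
  have := dist_triangle_left J J' (∑ i ∈ Finset.range N, A (x i) *ᵥ (F (x (i + 1)) - F (x i)))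
  linarith

/-! ### Matrix equations as families of vector equations -/

lemma intervalIntegral_apply {F : ℝ → Fin n → ℂ} {c d : ℝ}
    (hF : IntervalIntegrable F volume c d) (i : Fin n) :
    (∫ s in c..d, F s) i = ∫ s in c..d, F s i :=
  ((ContinuousLinearMap.proj (R := ℂ) (φ := fun _ : Fin n => ℂ) i).intervalIntegral_comp_comm
    hF).symm

lemma matIntegral_mulVec {A : ℝ → Matrix (Fin n) (Fin n) ℂ} {c d : ℝ}
    (hA : ∀ i j, IntervalIntegrable (fun s => A s i j) volume c d) (v : Fin n → ℂ) :
    matIntegral A c d *ᵥ v = ∫ s in c..d, A s *ᵥ v := by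
  have hAv : IntervalIntegrable (fun s => A s *ᵥ v) volume c d := by
    rw [intervalIntegrable_iff]
    refine Integrable.of_eval fun i => ?_
    simp only [Matrix.mulVec, dotProduct]
    exact integrable_finsetSum _ fun j _ => intervalIntegrable_iff.1 ((hA i j).mul_const _)
  ext i
  rw [intervalIntegral_apply hAv]
  simp only [Matrix.mulVec, dotProduct, matIntegral, Matrix.of_apply]
  rw [intervalIntegral.integral_finsetSum fun j _ => (hA i j).mul_const _]
  exact Finset.sum_congr rfl fun j _ => (intervalIntegral.integral_mul_const _ _).symm

namespace EvenKernel

variable {K : ℝ → Matrix (Fin n) (Fin n) ℂ} (hK : EvenKernel K) {a b : ℝ}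
include hK

lemma add_matIntegral_mulVec {V : ℝ → Matrix (Fin n) (Fin n) ℂ} (hV : Continuous V)
    (a ξ t : ℝ) (c : Fin n → ℂ) :
    (V t + matIntegral (fun s => K (t - s) * V s) a ξ) *ᵥ c =
      V t *ᵥ c + convOp K a ξ (fun s => V s *ᵥ c) t := by
  rw [Matrix.add_mulVec, matIntegral_mulVec]
  · simp only [convOp, Matrix.mulVec_mulVec]
  · intro i j
    have h1 := hK.intervalIntegrable_mulVec
      (continuous_mulVec_comp hV (continuous_const (y := Pi.single j 1))) t a ξ
    rw [intervalIntegrable_iff] at h1 ⊢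
    refine (Integrable.eval h1 i).congr (Eventually.of_forall fun s => ?_)
    change (K (t - s) *ᵥ (V s *ᵥ Pi.single j 1)) i = (K (t - s) * V s) i j
    rw [Matrix.mulVec_mulVec, Matrix.mulVec_single_one, Matrix.col_apply]

lemma add_matIntegral_eq_one_iff {V : ℝ → Matrix (Fin n) (Fin n) ℂ} (hV : Continuous V)
    (a ξ t : ℝ) :
    V t + matIntegral (fun s => K (t - s) * V s) a ξ = 1 ↔
      ∀ c, V t *ᵥ c + convOp K a ξ (fun s => V s *ᵥ c) t = c := by
  simp only [← hK.add_matIntegral_mulVec hV]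
  refine ⟨fun h c => by rw [h, Matrix.one_mulVec], fun h => ?_⟩
  refine Matrix.ext_of_mulVec_single fun j => ?_
  rw [h, Matrix.one_mulVec]

/-- The matrix solutions of the truncated equations depend continuously on all variables. -/
theorem exists_fundamental (hab : a ≤ b) (hinj : InjectiveTruncations K a b) :
    ∃ G : ℝ → ℝ → Matrix (Fin n) (Fin n) ℂ, Continuous (fun p : ℝ × ℝ => G p.1 p.2) ∧
      ∀ c : Fin n → ℂ, ∀ ξ ∈ Icc a b, ∀ t ∈ Icc a b,
        G ξ t *ᵥ c + convOp K a ξ (fun s => G ξ s *ᵥ c) t = c := by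
  obtain ⟨C, -, hC⟩ := hK.exists_solution hab hinj
  choose φ hφc hφ _ using fun j : Fin n => hC (fun _ => Pi.single j 1) continuous_const
  let G : ℝ → ℝ → Matrix (Fin n) (Fin n) ℂ := fun ξ t => Matrix.of fun i j => φ j ξ t i
  have hGc : Continuous fun p : ℝ × ℝ => G p.1 p.2 :=
    continuous_matrix fun i j => (continuous_apply i).comp (hφc j)
  have hcol : ∀ ξ t j, G ξ t *ᵥ Pi.single j 1 = φ j ξ t := fun ξ t j => by
    ext i; simp [G]
  refine ⟨G, hGc, fun c ξ hξ t ht => ?_⟩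
  have hGξ : Continuous (G ξ) := hGc.comp (Continuous.prodMk_right ξ)
  refine (hK.add_matIntegral_eq_one_iff hGξ a ξ t).1 (Matrix.ext_of_mulVec_single fun j => ?_) c
  rw [hK.add_matIntegral_mulVec hGξ, Matrix.one_mulVec]
  simp only [hcol]
  exact hφ j ξ hξ t ht

/-- A null vector `c` of `G ξ ξ` would make the solution with right-hand side `c` vanish on the
diagonal. -/
lemma det_diagonal_ne_zero (hab : a ≤ b) (hinj : InjectiveTruncations K a b)
    {G : ℝ → ℝ → Matrix (Fin n) (Fin n) ℂ} (hGc : Continuous fun p : ℝ × ℝ => G p.1 p.2)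
    (hG : ∀ c : Fin n → ℂ, ∀ ξ ∈ Icc a b, ∀ t ∈ Icc a b,
      G ξ t *ᵥ c + convOp K a ξ (fun s => G ξ s *ᵥ c) t = c) :
    ∀ ξ ∈ Icc a b, (G ξ ξ).det ≠ 0 := by
  intro ξ hξ hdet
  obtain ⟨c, hc, hc0⟩ := Matrix.exists_mulVec_eq_zero_iff.2 hdet
  exact hK.diagonal_ne_zero hab hinj hc (φ := fun ξ t => G ξ t *ᵥ c)
    (continuous_mulVec_comp hGc continuous_const)
    (fun ξ hξ t ht => hG c ξ hξ t ⟨ht.1, ht.2.trans hξ.2⟩) ξ hξ hc0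

end EvenKernel

/-! ### Replacing the class of `H` by an everywhere even kernel -/

/-- The even integrable kernel on the line which represents the class of `H` on `(-r, r)`. -/
def evenPart (H : ℝ → Matrix (Fin n) (Fin n) ℂ) (r : ℝ) : ℝ → Matrix (Fin n) (Fin n) ℂ :=
  indicator (Ioo (-r) r) fun t => (1 / 2 : ℂ) • (H t + H (-t))

section EvenPart

variable {H : ℝ → Matrix (Fin n) (Fin n) ℂ}

lemma evenKernel_evenPart {r : ℝ} (hH : IsIntegrableKernel H r) : EvenKernel (evenPart H r) := by
  have hneg : ∀ t : ℝ, -t ∈ Ioo (-r) r ↔ t ∈ Ioo (-r) r := fun t => by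
    simp only [mem_Ioo]; constructor <;> rintro ⟨h1, h2⟩ <;> constructor <;> linarith
  constructor
  · intro i j
    have h1 : Integrable (indicator (Ioo (-r) r) fun t => H t i j) :=
      (hH i j).integrable_indicator measurableSet_Ioo
    refine ((h1.add h1.comp_neg).const_mul (1 / 2 : ℂ)).congr (Eventually.of_forall fun t => ?_)
    by_cases ht : t ∈ Ioo (-r) r
    · simp only [evenPart, Pi.add_apply, indicator_of_mem ht, indicator_of_mem ((hneg t).2 ht)]
      simp
    · simp only [evenPart, Pi.add_apply, indicator_of_notMem ht,
        indicator_of_notMem (mt (hneg t).1 ht)]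
      simp
  · intro t
    by_cases ht : t ∈ Ioo (-r) r
    · simp only [evenPart, indicator_of_mem ht, indicator_of_mem ((hneg t).2 ht), neg_neg]
      rw [add_comm]
    · simp only [evenPart, indicator_of_notMem ht, indicator_of_notMem (mt (hneg t).1 ht)]

lemma evenPart_ae_eq {r : ℝ} (heven : IsEvenKernel H r) :
    ∀ᵐ x, x ∈ Ioo (-r) r → evenPart H r x = H x := by
  filter_upwards [(ae_restrict_iff' measurableSet_Ioo).1 heven] with x hx hxm
  rw [evenPart, indicator_of_mem hxm, hx hxm, ← two_smul ℂ (H x), smul_smul]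
  norm_num

variable {a b : ℝ} (heven : IsEvenKernel H (b - a)) {ξ t : ℝ} (hξ : ξ ∈ Icc a b)
  (ht : t ∈ Icc a ξ)
include heven hξ ht

/-- The point `s = ξ` is discarded because `t - s` can then be the excluded endpoint `a - b`. -/
lemma evenPart_sub_left_ae_eq : ∀ᵐ s, s ∈ uIoc a ξ → evenPart H (b - a) (t - s) = H (t - s) := by
  have h1 := (quasiMeasurePreserving_sub_left volume t).ae (evenPart_ae_eq heven)
  have h2 : ∀ᵐ s : ℝ, s ≠ ξ := by simp [ae_iff, measure_singleton]
  filter_upwards [h1, h2] with s hs hsξ hsm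
  rw [uIoc_of_le hξ.1] at hsm
  have := lt_of_le_of_ne hsm.2 hsξ
  exact hs ⟨by linarith [ht.1, hξ.2], by linarith [ht.2, hξ.2, hsm.1]⟩

lemma evenPart_sub_right_ae_eq : ∀ᵐ s, s ∈ uIoc a ξ → evenPart H (b - a) (s - t) = H (s - t) := by
  have h1 := (measurePreserving_sub_right volume t).quasiMeasurePreserving.ae
    (evenPart_ae_eq heven)
  have h2 : ∀ᵐ s : ℝ, s ≠ ξ := by simp [ae_iff, measure_singleton]
  filter_upwards [h1, h2] with s hs hsξ hsm
  rw [uIoc_of_le hξ.1] at hsm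
  have := lt_of_le_of_ne hsm.2 hsξ
  exact hs ⟨by linarith [ht.2, hξ.2, hsm.1], by linarith [ht.1, hξ.2]⟩

lemma matIntegral_evenPart {U V : ℝ → Matrix (Fin n) (Fin n) ℂ} (hUV : EqOn U V (Icc a ξ)) :
    matIntegral (fun s => H (t - s) * U s) a ξ =
      matIntegral (fun s => evenPart H (b - a) (t - s) * V s) a ξ := by
  ext i j
  refine intervalIntegral.integral_congr_ae ?_
  filter_upwards [evenPart_sub_left_ae_eq heven hξ ht] with s hs hsm
  rw [hs hsm, hUV (by rw [uIoc_of_le hξ.1] at hsm; exact Ioc_subset_Icc_self hsm)]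

/-- Transposition moves the kernel to the left and evenness turns `s - t` into `t - s`, so the dual
equation becomes a truncated equation for the transposed kernel. -/
lemma matIntegral_evenPart_dual (hH : IsIntegrableKernel H (b - a))
    {U V : ℝ → Matrix (Fin n) (Fin n) ℂ} (hUV : EqOn U V (Icc a ξ)) :
    (matIntegral (fun s => U s * H (s - t)) a ξ)ᵀ =
      matIntegral (fun s => (evenPart H (b - a) (t - s))ᵀ * (V s)ᵀ) a ξ := by
  ext i j
  refine intervalIntegral.integral_congr_ae ?_
  filter_upwards [evenPart_sub_right_ae_eq heven hξ ht] with s hs hsm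
  rw [(evenKernel_evenPart hH).sub_comm t s, hs hsm, ← Matrix.transpose_mul, Matrix.transpose_apply,
    hUV (by rw [uIoc_of_le hξ.1] at hsm; exact Ioc_subset_Icc_self hsm)]

lemma integral_mulVec_evenPart {u v : ℝ → Fin n → ℂ} (huv : EqOn u v (Icc a ξ)) :
    ∫ s in a..ξ, H (t - s) *ᵥ u s = convOp (evenPart H (b - a)) a ξ v t := by
  refine intervalIntegral.integral_congr_ae ?_
  filter_upwards [evenPart_sub_left_ae_eq heven hξ ht] with s hs hsm
  rw [hs hsm, huv (by rw [uIoc_of_le hξ.1] at hsm; exact Ioc_subset_Icc_self hsm)]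

end EvenPart

/-- A function which is continuous on `[c, d]` agrees there with a continuous function. -/
lemma exists_continuous_eqOn {E : Type*} [TopologicalSpace E] {c d : ℝ} (hcd : c ≤ d)
    {u : ℝ → E} (hu : ContinuousOn u (Icc c d)) :
    ∃ v : ℝ → E, Continuous v ∧ EqOn u v (Icc c d) :=
  ⟨IccExtend hcd ((Icc c d).domRestrict u), hu.domRestrict.Icc_extend',
    fun t ht => by rw [IccExtend_of_mem hcd _ ht]; rfl⟩

section Solutions

variable {H : ℝ → Matrix (Fin n) (Fin n) ℂ} {a b : ℝ} (hH : IsIntegrableKernel H (b - a))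
  (heven : IsEvenKernel H (b - a))
include hH heven

lemma isTruncatedSolution_iff {ξ : ℝ} (hξ : ξ ∈ Icc a b) {U V : ℝ → Matrix (Fin n) (Fin n) ℂ}
    (hV : Continuous V) (hUV : EqOn U V (Icc a ξ)) :
    IsTruncatedSolution H a ξ U ↔ ∀ c, ∀ t ∈ Icc a ξ,
      V t *ᵥ c + convOp (evenPart H (b - a)) a ξ (fun s => V s *ᵥ c) t = c := by
  have h1 : ∀ t ∈ Icc a ξ, (U t + matIntegral (fun s => H (t - s) * U s) a ξ = 1 ↔
      ∀ c, V t *ᵥ c + convOp (evenPart H (b - a)) a ξ (fun s => V s *ᵥ c) t = c) := fun t ht => by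
    rw [matIntegral_evenPart heven hξ ht hUV, hUV ht,
      (evenKernel_evenPart hH).add_matIntegral_eq_one_iff hV]
  refine ⟨fun h c t ht => (h1 t ht).1 (h.2 t ht) c, fun h => ⟨hV.continuousOn.congr hUV,
    fun t ht => (h1 t ht).2 fun c => h c t ht⟩⟩

lemma isDualTruncatedSolution_iff {ξ : ℝ} (hξ : ξ ∈ Icc a b)
    {U V : ℝ → Matrix (Fin n) (Fin n) ℂ} (hV : Continuous V) (hUV : EqOn U V (Icc a ξ)) :
    IsDualTruncatedSolution H a ξ U ↔ ∀ c, ∀ t ∈ Icc a ξ,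
      (V t)ᵀ *ᵥ c + convOp (fun x => (evenPart H (b - a) x)ᵀ) a ξ (fun s => (V s)ᵀ *ᵥ c) t = c := by
  have h1 : ∀ t ∈ Icc a ξ, (U t + matIntegral (fun s => U s * H (s - t)) a ξ = 1 ↔
      ∀ c, (V t)ᵀ *ᵥ c +
        convOp (fun x => (evenPart H (b - a) x)ᵀ) a ξ (fun s => (V s)ᵀ *ᵥ c) t = c) :=
    fun t ht => by
      rw [← Matrix.transpose_inj, Matrix.transpose_one, Matrix.transpose_add,
        matIntegral_evenPart_dual heven hξ ht hH hUV, hUV ht,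
        ← (evenKernel_evenPart hH).transpose.add_matIntegral_eq_one_iff hV.matrix_transpose]
  refine ⟨fun h c t ht => (h1 t ht).1 (h.2 t ht) c, fun h => ⟨hV.continuousOn.congr hUV,
    fun t ht => (h1 t ht).2 fun c => h c t ht⟩⟩

omit hH in
lemma isSolution_iff (hab : a ≤ b) {f φ ψ : ℝ → Fin n → ℂ} (hψ : Continuous ψ)
    (hφψ : EqOn φ ψ (Icc a b)) :
    IsSolution H a b f φ ↔
      ∀ t ∈ Icc a b, ψ t + convOp (evenPart H (b - a)) a b ψ t = f t := by
  have hb : b ∈ Icc a b := ⟨hab, le_rfl⟩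
  have h1 : ∀ t ∈ Icc a b, φ t + ∫ s in a..b, H (t - s) *ᵥ φ s =
      ψ t + convOp (evenPart H (b - a)) a b ψ t := fun t ht => by
    rw [integral_mulVec_evenPart heven hb ht hφψ, hφψ ht]
  refine ⟨fun h t ht => by rw [← h1 t ht]; exact h.2 t ht, fun h => ⟨hψ.continuousOn.congr hφψ,
    fun t ht => by rw [h1 t ht]; exact h t ht⟩⟩

/-- Unique solvability of the truncated equations makes the truncated operators injective. -/
lemma injectiveTruncations_of_isUniqueOn {g : ℝ → ℝ → Matrix (Fin n) (Fin n) ℂ}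
    (hg : ∀ ξ ∈ Icc a b, IsUniqueOn (IsTruncatedSolution H a ξ) a ξ (fun t => g t ξ)) :
    InjectiveTruncations (evenPart H (b - a)) a b := by
  intro ξ hξ u hu hu0 t ht
  obtain ⟨V, hV, hgV⟩ := exists_continuous_eqOn hξ.1 (hg ξ hξ).1.1
  ext i
  -- Adding a homogeneous solution to every column of `g` gives another matrix solution, so
  -- uniqueness forces `u = 0`.
  let W : ℝ → Matrix (Fin n) (Fin n) ℂ := fun s => V s + Matrix.of fun k _ => u s k
  have hW : Continuous W := hV.add (continuous_matrix fun k _ => (continuous_apply k).comp hu)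
  have hWc : ∀ s c, W s *ᵥ c = V s *ᵥ c + (∑ j, c j) • u s := fun s c => by
    simp only [W, Matrix.add_mulVec]
    congr 1
    ext k
    simp [Matrix.mulVec, dotProduct, Finset.mul_sum, mul_comm]
  have hsol := (isTruncatedSolution_iff hH heven hξ hV hgV).1 (hg ξ hξ).1
  have hWsol : IsTruncatedSolution H a ξ W := by
    refine (isTruncatedSolution_iff hH heven hξ hW fun s _ => rfl).2 fun c s hs => ?_
    simp only [hWc]
    rw [(evenKernel_evenPart hH).convOp_add (continuous_mulVec_comp hV continuous_const)
      (hu.fun_const_smul _), EvenKernel.convOp_smul, add_add_add_comm, hsol c s hs, ← smul_add,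
      hu0 s hs, smul_zero, add_zero]
  have h1 := (hg ξ hξ).2 W hWsol ht
  have h2 : W t = V t := h1.trans (hgV ht)
  have h3 := congrFun (congrFun h2 i) i
  simpa [W] using h3

end Solutions

end KreinMethod

end

namespace KreinMethod

open Filter Topology

variable {n : ℕ}

lemma absolutelyContinuousOnInterval_congr {X : Type*} [PseudoMetricSpace X] {f g : ℝ → X}
    {a b : ℝ} (hf : AbsolutelyContinuousOnInterval f a b) (hfg : EqOn f g (uIcc a b)) :
    AbsolutelyContinuousOnInterval g a b := by
  rw [absolutelyContinuousOnInterval_iff] at hf ⊢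
  intro ε hε
  obtain ⟨δ, hδ, h⟩ := hf ε hε
  refine ⟨δ, hδ, fun E hE hlen => lt_of_eq_of_lt (Finset.sum_congr rfl fun i hi => ?_)
    (h E hE hlen)⟩
  rw [hfg (hE.1 i hi).1, hfg (hE.1 i hi).2]

/-! ### The derivatives of `M` and of the dual moment -/

section Derivatives

variable {K : ℝ → Matrix (Fin n) (Fin n) ℂ} (hK : EvenKernel K) {a b : ℝ}
  {G Γ : ℝ → ℝ → Matrix (Fin n) (Fin n) ℂ}
  (hGc : Continuous fun p : ℝ × ℝ => G p.1 p.2) (hΓc : Continuous fun p : ℝ × ℝ => Γ p.1 p.2)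
  (hG : ∀ c : Fin n → ℂ, ∀ ξ ∈ Icc a b, ∀ t ∈ Icc a b,
    G ξ t *ᵥ c + convOp K a ξ (fun s => G ξ s *ᵥ c) t = c)
  (hΓ : ∀ c : Fin n → ℂ, ∀ ξ ∈ Icc a b, ∀ t ∈ Icc a b,
    Γ ξ t *ᵥ c + convOp (fun x => (K x)ᵀ) a ξ (fun s => Γ ξ s *ᵥ c) t = c)
include hK hΓc hΓ

/-- The `i`-th coordinate pairs `f` with column `i` of `Γ`, which solves the transposed equation
with right-hand side the `i`-th basis vector; this is a scalar moment already differentiated. -/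
lemma hasDerivWithinAt_dualMoment {f φ' : ℝ → Fin n → ℂ} {φ : ℝ → ℝ → Fin n → ℂ}
    (hf : EqOn f φ' (Icc a b)) (hφ'c : Continuous φ')
    (hφc : Continuous fun p : ℝ × ℝ => φ p.1 p.2)
    (hφ : ∀ ξ ∈ Icc a b, ∀ t ∈ Icc a b, φ ξ t + convOp K a ξ (φ ξ) t = φ' t)
    {ξ : ℝ} (hξ : ξ ∈ Icc a b) :
    HasDerivWithinAt (dualMoment (fun t ξ => (Γ ξ t)ᵀ) f a) ((Γ ξ ξ)ᵀ *ᵥ φ ξ ξ) (Icc a b) ξ := by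
  have hrow : ∀ (A : Matrix (Fin n) (Fin n) ℂ) (v : Fin n → ℂ) (i : Fin n),
      (Aᵀ *ᵥ v) i = (A *ᵥ Pi.single i 1) ⬝ᵥ v := fun A v i => by
    rw [Matrix.mulVec_single_one]; rfl
  refine hasDerivWithinAt_pi.2 fun i => ?_
  rw [hrow]
  refine (hK.hasDerivWithinAt_integral_dotProduct (c := Pi.single i 1)
    (χ := fun ξ t => Γ ξ t *ᵥ Pi.single i 1) (continuous_mulVec_comp hΓc continuous_const) hφc
    (hΓ _) hφ hξ).congr_of_mem (fun η hη => ?_) hξ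
  have hΓη : Continuous fun s => (Γ η s)ᵀ :=
    (hΓc.comp (Continuous.prodMk_right η)).matrix_transpose
  have h1 : dualMoment (fun t ξ => (Γ ξ t)ᵀ) f a η = ∫ s in a..η, (Γ η s)ᵀ *ᵥ φ' s := by
    refine intervalIntegral.integral_congr fun s hs => ?_
    rw [uIcc_of_le hη.1] at hs
    simp only [hf ⟨hs.1, hs.2.trans hη.2⟩]
  rw [h1, intervalIntegral_apply ((continuous_mulVec_comp hΓη hφ'c).intervalIntegrable _ _)]
  exact intervalIntegral.integral_congr fun s _ => hrow _ _ _

include hGc hG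

/-- An entry of `M` integrates a basis vector against a column of `G`; by adjointness it equals the
moment of a column of `Γ` against a basis vector. -/
lemma hasDerivWithinAt_M {g : ℝ → ℝ → Matrix (Fin n) (Fin n) ℂ}
    (hgG : ∀ ξ ∈ Icc a b, EqOn (G ξ) (fun t => g t ξ) (Icc a ξ)) {ξ : ℝ} (hξ : ξ ∈ Icc a b)
    (i j : Fin n) :
    HasDerivWithinAt (fun η => M g a η i j) (((Γ ξ ξ)ᵀ * g ξ ξ) i j) (Icc a b) ξ := by
  have hd := hK.hasDerivWithinAt_integral_dotProduct (c := Pi.single i 1)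
    (χ := fun ξ t => Γ ξ t *ᵥ Pi.single i 1) (φ := fun ξ t => G ξ t *ᵥ Pi.single j 1)
    (continuous_mulVec_comp hΓc continuous_const) (continuous_mulVec_comp hGc continuous_const)
    (hΓ _) (hG _) hξ
  have hval : (Γ ξ ξ *ᵥ Pi.single i 1) ⬝ᵥ (G ξ ξ *ᵥ Pi.single j 1) = ((Γ ξ ξ)ᵀ * g ξ ξ) i j := by
    have hd : G ξ ξ = g ξ ξ := hgG ξ hξ ⟨hξ.1, le_rfl⟩
    rw [← hd, Matrix.mulVec_single_one, Matrix.mulVec_single_one]; rfl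
  rw [← hval]
  refine hd.congr_of_mem (fun η hη => ?_) hξ
  rw [hK.integral_dotProduct_eq (χ := fun ξ t => Γ ξ t *ᵥ Pi.single i 1)
    (φ := fun ξ t => G ξ t *ᵥ Pi.single j 1)
    (continuous_mulVec_comp hΓc continuous_const) (continuous_mulVec_comp hGc continuous_const)
    (hΓ _) (hG _) hη]
  refine intervalIntegral.integral_congr fun s hs => ?_
  rw [uIcc_of_le hη.1] at hs
  simp only [← hgG η hη hs, Matrix.mulVec_single_one, single_one_dotProduct, Matrix.col_apply]

end Derivatives

end KreinMethod

/-! ### The theorem -/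

theorem theorem4p1 {n : ℕ} {a b : ℝ} (hab : a < b)
    (H : ℝ → Matrix (Fin n) (Fin n) ℂ)
    (hH : KreinMethod.IsIntegrableKernel H (b - a))
    (heven : KreinMethod.IsEvenKernel H (b - a))
    (g : ℝ → ℝ → Matrix (Fin n) (Fin n) ℂ)
    (hg : ∀ ξ ∈ Icc a b,
      KreinMethod.IsUniqueOn (KreinMethod.IsTruncatedSolution H a ξ) a ξ (fun t => g t ξ)) :
    ∃ gs : ℝ → ℝ → Matrix (Fin n) (Fin n) ℂ,
      -- `gs` is `g*`: the dual truncated equations are uniquely solvable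
      (∀ ξ ∈ Icc a b,
        KreinMethod.IsUniqueOn (KreinMethod.IsDualTruncatedSolution H a ξ) a ξ
          (fun t => gs t ξ)) ∧
      -- nondegeneracy
      (∀ ξ ∈ Icc a b, (gs ξ ξ * g ξ ξ).det ≠ 0) ∧
      -- `M' = g*(ξ, ξ) g(ξ, ξ)`
      (∀ ξ ∈ Icc a b, ∀ i j,
        HasDerivWithinAt (fun η => KreinMethod.M g a η i j) ((gs ξ ξ * g ξ ξ) i j)
          (Icc a b) ξ) ∧
      ∀ f : ℝ → Fin n → ℂ, ContinuousOn f (Icc a b) →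
        -- the derivative inside the formula exists, and `F` is continuous
        DifferentiableOn ℝ (KreinMethod.dualMoment gs f a) (Icc a b) ∧
        ContinuousOn (KreinMethod.kreinF g gs f a b) (Icc a b) ∧
        ∃ φ : ℝ → Fin n → ℂ,
          KreinMethod.IsUniqueOn (KreinMethod.IsSolution H a b f) a b φ ∧
          -- the formula, with `∫_t^b g(t, ξ) dF(ξ)` as a Stieltjes integral
          (∀ t ∈ Icc a b, ∃ J : Fin n → ℂ,
            KreinMethod.HasStieltjesIntegral (fun ξ => g t ξ)
              (KreinMethod.kreinF g gs f a b) t b J ∧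
            φ t = g t b *ᵥ KreinMethod.kreinF g gs f a b b - J) ∧
          -- for absolutely continuous `f` the outer derivative is an honest one
          (AbsolutelyContinuousOnInterval f a b →
            AbsolutelyContinuousOnInterval (KreinMethod.kreinF g gs f a b) a b ∧
            (∀ᵐ ξ ∂(volume.restrict (Icc a b)),
              DifferentiableAt ℝ (KreinMethod.kreinF g gs f a b) ξ) ∧
            ∀ t ∈ Icc a b,
              IntervalIntegrable
                (fun ξ => g t ξ *ᵥ deriv (KreinMethod.kreinF g gs f a b) ξ) volume t b ∧
              φ t = g t b *ᵥ KreinMethod.kreinF g gs f a b b -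
                ∫ ξ in t..b, g t ξ *ᵥ deriv (KreinMethod.kreinF g gs f a b) ξ) := by
  open KreinMethod in
  set K := evenPart H (b - a) with hKdef
  have hK : EvenKernel K := evenKernel_evenPart hH
  have hinj : InjectiveTruncations K a b := injectiveTruncations_of_isUniqueOn hH heven hg
  have hinjT := hK.injectiveTruncations_transpose hab.le hinj
  obtain ⟨G, hGc, hG⟩ := hK.exists_fundamental hab.le hinj
  obtain ⟨Γ, hΓc, hΓ⟩ := hK.transpose.exists_fundamental hab.le hinjT
  have hGξ : ∀ ξ, Continuous (G ξ) := fun ξ => hGc.comp (Continuous.prodMk_right ξ)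
  have hΓξ : ∀ ξ, Continuous (Γ ξ) := fun ξ => hΓc.comp (Continuous.prodMk_right ξ)
  -- The given `g` is prescribed only for `t ≤ ξ`; there it agrees with the jointly continuous `G`.
  have hgG : ∀ ξ ∈ Icc a b, EqOn (G ξ) (fun t => g t ξ) (Icc a ξ) := fun ξ hξ =>
    (hg ξ hξ).2 (G ξ) ((isTruncatedSolution_iff hH heven hξ (hGξ ξ) fun _ _ => rfl).2
      fun c t ht => hG c ξ hξ t ⟨ht.1, ht.2.trans hξ.2⟩)
  have hgGd : ∀ ξ ∈ Icc a b, g ξ ξ = G ξ ξ := fun ξ hξ => (hgG ξ hξ ⟨hξ.1, le_rfl⟩).symm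
  have hGdet := hK.det_diagonal_ne_zero hab.le hinj hGc hG
  have hΓdet := hK.transpose.det_diagonal_ne_zero hab.le hinjT hΓc hΓ
  have hM : ∀ ξ ∈ Icc a b, ∀ i j, HasDerivWithinAt (fun η => M g a η i j)
      (((Γ ξ ξ)ᵀ * g ξ ξ) i j) (Icc a b) ξ := fun ξ hξ i j =>
    hasDerivWithinAt_M hK hGc hΓc hG hΓ hgG hξ i j
  refine ⟨fun t ξ => (Γ ξ t)ᵀ, fun ξ hξ => ⟨?_, fun v hv => ?_⟩, fun ξ hξ => ?_, hM,
    fun f hf => ?_⟩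
  · refine (isDualTruncatedSolution_iff hH heven hξ (hΓξ ξ).matrix_transpose fun _ _ => rfl).2
      fun c t ht => ?_
    simp only [Matrix.transpose_transpose]
    exact hΓ c ξ hξ t ⟨ht.1, ht.2.trans hξ.2⟩
  · obtain ⟨V, hV, hvV⟩ := exists_continuous_eqOn hξ.1 hv.1
    have hVsol := (isDualTruncatedSolution_iff hH heven hξ hV hvV).1 hv
    intro t ht
    rw [hvV ht]
    refine Matrix.transpose_injective (Matrix.ext_of_mulVec_single fun j => ?_)
    rw [Matrix.transpose_transpose]
    refine hK.transpose.eqOn_of_solves hinjT hξ (u := fun s => (V s)ᵀ *ᵥ Pi.single j 1)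
      (v := fun s => Γ ξ s *ᵥ Pi.single j 1)
      (continuous_mulVec_comp hV.matrix_transpose continuous_const)
      (continuous_mulVec_comp (hΓξ ξ) continuous_const) (fun s hs => ?_) ht
    rw [hVsol _ s hs, hΓ _ ξ hξ s ⟨hs.1, hs.2.trans hξ.2⟩]
  · rw [hgGd ξ hξ, Matrix.det_mul, Matrix.det_transpose]
    exact mul_ne_zero (hΓdet ξ hξ) (hGdet ξ hξ)
  obtain ⟨f', hf'c, hff'⟩ := exists_continuous_eqOn hab.le hf
  obtain ⟨_, _, hsolve⟩ := hK.exists_solution hab.le hinj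
  obtain ⟨φ, hφc, hφ, -⟩ := hsolve f' hf'c
  have hφd : Continuous fun ξ => φ ξ ξ := hφc.comp (continuous_id.prodMk continuous_id)
  have hGd : Continuous fun ξ => G ξ ξ := hGc.comp (continuous_id.prodMk continuous_id)
  have hΦ : ∀ ξ ∈ Icc a b, HasDerivWithinAt (dualMoment (fun t ξ => (Γ ξ t)ᵀ) f a)
      ((Γ ξ ξ)ᵀ *ᵥ φ ξ ξ) (Icc a b) ξ := fun ξ hξ =>
    hasDerivWithinAt_dualMoment hK hΓc hΓ hff' hf'c hφc hφ hξ
  set F := kreinF g (fun t ξ => (Γ ξ t)ᵀ) f a b with hFdef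
  -- The factor `(Γ ξ ξ)ᵀ` occurs both in `M'` and in the derivative of the dual moment, and
  -- cancels.
  have hFeq : ∀ ξ ∈ Icc a b, F ξ = (G ξ ξ)⁻¹ *ᵥ φ ξ ξ := fun ξ hξ => by
    have hu := uniqueDiffOn_Icc hab ξ hξ
    have h1 : matDerivWithin (M g a) (Icc a b) ξ = (Γ ξ ξ)ᵀ * G ξ ξ := by
      ext i j
      rw [← hgGd ξ hξ, ← (hM ξ hξ i j).derivWithin hu]
      rfl
    have hΓu : IsUnit ((Γ ξ ξ)ᵀ).det := by
      rw [Matrix.det_transpose]; exact isUnit_iff_ne_zero.2 (hΓdet ξ hξ)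
    rw [hFdef, kreinF, h1, (hΦ ξ hξ).derivWithin hu, Matrix.mul_inv_rev, Matrix.mulVec_mulVec,
      Matrix.mul_assoc, Matrix.nonsing_inv_mul _ hΓu, Matrix.mul_one]
  have hFd : ∀ ξ ∈ Icc a b, φ ξ ξ = G ξ ξ *ᵥ F ξ := fun ξ hξ => by
    rw [hFeq ξ hξ, Matrix.mulVec_mulVec,
      Matrix.mul_nonsing_inv _ (isUnit_iff_ne_zero.2 (hGdet ξ hξ)), Matrix.one_mulVec]
  have hFc : ContinuousOn F (Icc a b) := by
    have h1 := continuousOn_inv hGd.continuousOn hGdet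
    have h2 : Continuous fun q : Matrix (Fin n) (Fin n) ℂ × (Fin n → ℂ) => q.1 *ᵥ q.2 :=
      continuous_mulVec_comp continuous_fst continuous_snd
    exact (h2.comp_continuousOn (h1.prodMk hφd.continuousOn)).congr hFeq
  have hb : b ∈ Icc a b := ⟨hab.le, le_rfl⟩
  have hφb : Continuous (φ b) := hφc.comp (Continuous.prodMk_right b)
  have hgt : ∀ t ∈ Icc a b, ∀ ξ ∈ Icc t b, g t ξ = G ξ t := fun t ht ξ hξ =>
    (hgG ξ ⟨ht.1.trans hξ.1, hξ.2⟩ ⟨ht.1, hξ.1⟩).symm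
  have hSt : ∀ t ∈ Icc a b, HasStieltjesIntegral (fun ξ => g t ξ) F t b
      (G b t *ᵥ F b - φ b t) := fun t ht =>
    hK.hasStieltjesIntegral hGc hφc hG hφ hab.le hinj hFc hFd ht (hgt t ht)
  refine ⟨fun ξ hξ => (hΦ ξ hξ).differentiableWithinAt, hFc, φ b, ⟨?_, fun v hv => ?_⟩,
    fun t ht => ⟨_, hSt t ht, ?_⟩, fun hfac => ?_⟩
  · refine (isSolution_iff heven hab.le hφb fun _ _ => rfl).2 fun t ht => ?_
    rw [hff' ht]; exact hφ b hb t ht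
  · obtain ⟨V, hV, hvV⟩ := exists_continuous_eqOn hab.le hv.1
    have hVsol := (isSolution_iff heven hab.le hV hvV).1 hv
    intro t ht
    rw [hvV ht]
    refine hK.eqOn_of_solves hinj hb hV hφb (fun s hs => ?_) ht
    rw [hVsol s hs, hφ b hb s hs, hff' hs]
  · rw [hgt t ht b ⟨ht.2, le_rfl⟩, sub_sub_cancel]
  have hFac : AbsolutelyContinuousOnInterval F a b :=
    hK.absolutelyContinuousOnInterval_quotient hGc hφc hG hφ hab.le hinj hFc hFd hGdet
      (absolutelyContinuousOnInterval_congr hfac (by rwa [uIcc_of_le hab.le]))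
  refine ⟨hFac, ?_, fun t ht => ?_⟩
  · rw [ae_restrict_iff' measurableSet_Icc, ← uIcc_of_le hab.le]
    exact (absolutelyContinuous_integral_deriv hFac).1
  have hgc : ContinuousOn (fun ξ => g t ξ) (Icc t b) :=
    (hGc.comp (continuous_id.prodMk continuous_const)).continuousOn.congr (hgt t ht)
  have hsub : Icc t b ⊆ Icc a b := Icc_subset_Icc_left ht.1
  have hFTC : ∀ x ∈ Icc t b, ∀ y ∈ Icc t b, IntervalIntegrable (deriv F) volume x y ∧
      ∫ s in x..y, deriv F s = F y - F x := fun x hx y hy =>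
    (absolutelyContinuous_integral_deriv (hFac.mono (by
      rw [uIcc_of_le hab.le]; exact uIcc_subset_Icc (hsub hx) (hsub hy)))).2
  have hint := (hFTC t ⟨le_rfl, ht.2⟩ b ⟨ht.2, le_rfl⟩).1
  refine ⟨intervalIntegrable_mulVec_of_continuousOn (by rwa [uIcc_of_le ht.2]) hint, ?_⟩
  -- The same Stieltjes integral has two values, the Lebesgue integral and `G b t *ᵥ F b - φ b t`;
  -- uniqueness equates them.
  have hL := hasStieltjesIntegral_of_integral_eq_sub ht.2 hgc hint
    fun x hx y hy => (hFTC x hx y hy).2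
  rw [← (hSt t ht).unique ht.2 hL, hgt t ht b ⟨ht.2, le_rfl⟩, sub_sub_cancel]
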